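/- \textbf{Notation.} For a set $S\subseteq\mathbb{Z}^d$ and $s>0$ let $D_{S,s}$ be the distribution on $S$ with probabilities proportional to $\exp(-\pi\|x\|^2/s^2)$; $D_{\mathbb{Z},s}^{d}$ denotes $d$ independent samples of $D_{\mathbb{Z},s}$. A sequence is negligible if it tends to $0$ faster than every inverse polynomial in $n$. Let $k=\lceil\log_2 q\rceil$, $m=\bar m+nk$, $G=I_n\otimes(1,2,\dots,2^{k-1})\in\mathbb{Z}_q^{n\times nk}$. For $x\in\mathbb{Z}_q^m$ let $BD(x)\in\{0,1\}^{mk}$ be the vector of the bits $0,\dots,k-1$ of the representatives in $\{0,\dots,q-1\}$ of the entries of $x$, and $P2(x)=(x,2x,\dots,2^{k-1}x)\in\mathbb{Z}_q^{mk}$ (in the matching order). Let $s_1(R)$ be the largest singular value of $R$. \textbf{Scheme Selective-IB-uPRE} (security parameter $n$; identities are the vectors $id\in\mathbb{Z}_q^n\setminus\{0\}$, encoded by invertible matrices $H_{id}\in\mathbb{Z}_q^{n\times n}$, for instance by a full-rank difference map). \begin{itemize} \item SetUp: choose $\bar A\in\mathbb{Z}_q^{n\times\bar m}$ and $u\in\mathbb{Z}_q^n$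 uniformly, $R\leftarrow D_{\mathbb{Z},r}^{\bar m\times nk}$; publish $PP=(A,u)$ with $A=[\bar A\mid-\bar AR]$; the master key is $R$. Put $A_{id}=[\bar A\mid-\bar AR+H_{id}G]$. \item Extract: $x_{id}\in\mathbb{Z}^m$ is sampled from a distribution within statistical distance $\delta(n)$ of $D_{\Lambda,s}$, where $\Lambda=\{z\in\mathbb{Z}^m: A_{id}z=u \bmod q\}$ and $s=\sigma\sqrt{s_1(R)^2+1}\cdot r$. \item Enc$(PP,id,b)$, $b\in\{0,1\}$: choose $\mathbf s\in\mathbb{Z}_q^n$ uniformly, $e\leftarrow D_{\mathbb{Z},\alpha q}$, $e_0\leftarrow D_{\mathbb{Z},\alpha q}^{\bar m}$, $e_1\leftarrow D_{\mathbb{Z},s'}^{nk}$ with $s'^2=(\|e_0\|^2+\bar m(\alpha q)^2)r^2$; output $c_1=A_{id}^t\mathbf s+(e_0,e_1)$ and $c_2=u^t\mathbf s+e+b\lfloor q/2\rfloor$ modulo $q$. \item Dec$(PP,x,(c_1,c_2))$: output $0$ if $c_2-x^tc_1$ is closer to $0$ than to $\lfloor q/2\rfloor$ modulo $q$, otherwise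 $1$. \item ReKeyGen$(PP,x_{id_i},id_i,id_j)$: choose $r_1\leftarrow D_{\mathbb{Z},r}^{mk\times n}$, $r_2\leftarrow D_{\mathbb{Z},r}^{mk}$; output $rk=\begin{pmatrix} r_1A_{id_j} & r_1u+r_2-P2(x_{id_i})\\ 0&1\end{pmatrix}$ over $\mathbb{Z}_q$. \item ReEnc$(rk,(c_1,c_2))$: output $(\bar c_1,\bar c_2)$ with $[\bar c_1^t\mid\bar c_2]=[BD(c_1)^t\mid c_2]\cdot rk$. \end{itemize} \textbf{Theorem (correctness).} For all constants $c,\sigma>0$ there is a constant $C>0$ such that the following holds. Let $q,\bar m,r,\alpha,\delta$ be functions of $n$ such that: $q$ is a prime power for every $n$, and $q$ is bounded by a polynomial in $n$; $\bar m\ge1$ and $\bar m\le c\,nk$ for all large $n$; $r>0$, $r=\omega(\sqrt{\log n})$ and $r=o(\sqrt n)$; $q$ is large enough, in the sense that $q\ge C(nk)^{3/2}r$ for all large $n$; $\alpha>0$ and $1/\alpha\ge C(nk)^2r^2$ for all large $n$; and $\delta$ is negligible, where the distance bound $\delta(n)$ of Extract holds for all $\bar A$, $R$, $u$ and all invertible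 tags. Then Selective-IB-uPRE is a correct single-hop scheme: there is a negligible function $\varepsilon$ such that for all $n$, all bits $b$ and all identities $id_i,id_j$, \begin{itemize} \item a ciphertext Enc$(PP,id_i,b)$ is decrypted to $b$ under $x_{id_i}$ with probability at least $1-\varepsilon(n)$, and \item the re-encryption of Enc$(PP,id_i,b)$ with a key from ReKeyGen$(PP,x_{id_i},id_i,id_j)$ is decrypted to $b$ under $x_{id_j}$ with probability at least $1-\varepsilon(n)$, \end{itemize} where the probability is over all the random choices of SetUp, Extract (run independently for $id_i$ and for $id_j$), Enc and ReKeyGen. -/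

import Mathlib

open scoped Matrix
open Filter Asymptotics

noncomputable section

namespace IBPRE

/-! ### Probability -/

/-- A real sequence is negligible if it decays faster than every inverse polynomial. -/
def Negligible (ε : ℕ → ℝ) : Prop :=
  SuperpolynomialDecay atTop (fun n : ℕ => (n : ℝ)) ε

/-- Statistical distance of two distributions. -/
def statDist {Ω : Type} (P Q : PMF Ω) : ℝ :=
  (1 / 2) * ∑' w, |(P w).toReal - (Q w).toReal|

/-- Squared Euclidean norm of an integer vector. -/
def sqNorm {ι : Type} [Fintype ι] (x : ι → ℤ) : ℝ := ∑ i, (x i : ℝ) ^ 2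

/-- The Gaussian weight `exp (-π ‖x‖² / s²)`, restricted to the set `S`. -/
def gaussianWeight {ι : Type} [Fintype ι] (S : Set (ι → ℤ)) (s : ℝ) : (ι → ℤ) → ENNReal :=
  S.indicator fun x => ENNReal.ofReal (Real.exp (-Real.pi * sqNorm x / s ^ 2))

open Classical in
/-- The discrete Gaussian distribution `D_{S, s}` on a set `S` of integer vectors (a lattice or a
coset of a lattice), centred at `0`. For nonempty `S` and `s > 0` the total weight is positive
and finite; in the degenerate cases the value is the point mass at `0`. -/
def discreteGaussian {ι : Type} [Fintype ι] (S : Set (ι → ℤ)) (s : ℝ) : PMF (ι → ℤ) :=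
  if h : (∑' x, gaussianWeight S s x) ≠ 0 ∧ (∑' x, gaussianWeight S s x) ≠ ⊤ then
    PMF.normalize (gaussianWeight S s) h.1 h.2
  else PMF.pure 0

/-- `D_{ℤ, s}^ι`: independent coordinates, each from `D_{ℤ, s}`. As the weight is a product over
the coordinates, this is the discrete Gaussian on the whole of `ℤ^ι`. -/
def gaussianVec (ι : Type) [Fintype ι] (s : ℝ) : PMF (ι → ℤ) :=
  discreteGaussian Set.univ s

/-- `D_{ℤ, s}`. -/
def gaussianInt (s : ℝ) : PMF ℤ := (gaussianVec Unit s).map fun x => x ()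

/-- `D_{ℤ, s}^{ι × κ}`: a matrix with independent entries from `D_{ℤ, s}`. -/
def gaussianMatrix (ι κ : Type) [Fintype ι] [Fintype κ] (s : ℝ) : PMF (Matrix ι κ ℤ) :=
  (gaussianVec (ι × κ) s).map fun x => Matrix.of fun i j => x (i, j)

/-! ### Identity-based unidirectional proxy re-encryption -/

/-- The algorithms of an identity-based unidirectional proxy re-encryption scheme, at one value of
the security parameter. `dec` may return the error symbol `none`. -/
structure Scheme where
  PP : Type
  MSK : Type
  ID : Type
  SK : Type
  RK : Type
  CT : Type
  Msg : Type
  setup : PMF (PP × MSK)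
  extract : PP → MSK → ID → PMF SK
  reKeyGen : PP → SK → ID → ID → PMF RK
  enc : PP → ID → Msg → PMF CT
  reEnc : PP → RK → CT → PMF CT
  dec : PP → SK → CT → Option Msg

/-- Encrypt `μ` for `id` and decrypt with the secret key of `id`. -/
def Scheme.decOriginal (E : Scheme) (id : E.ID) (μ : E.Msg) : PMF (Option E.Msg) :=
  E.setup.bind fun p =>
  (E.extract p.1 p.2 id).bind fun sk =>
  (E.enc p.1 id μ).bind fun ct =>
  PMF.pure (E.dec p.1 sk ct)

/-- Encrypt `μ` for `idi`, re-encrypt once from `idi` to `idj`, and decrypt with the secret key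
of `idj`. -/
def Scheme.decReEncrypted (E : Scheme) (idi idj : E.ID) (μ : E.Msg) : PMF (Option E.Msg) :=
  E.setup.bind fun p =>
  (E.extract p.1 p.2 idi).bind fun ski =>
  (E.extract p.1 p.2 idj).bind fun skj =>
  (E.reKeyGen p.1 ski idi idj).bind fun rk =>
  (E.enc p.1 idi μ).bind fun ct =>
  (E.reEnc p.1 rk ct).bind fun ct' =>
  PMF.pure (E.dec p.1 skj ct')

/-- Single-hop correctness of a scheme with security parameter `n`: original ciphertexts and
ciphertexts that were re-encrypted once are decrypted to the encrypted message with overwhelming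
probability, uniformly in the identities and the message. -/
def SingleHopCorrect (E : ℕ → Scheme) : Prop :=
  ∃ ε : ℕ → ℝ, Negligible ε ∧ ∀ (n : ℕ) (μ : (E n).Msg),
    (∀ id : (E n).ID, 1 - ε n ≤ ((E n).decOriginal id μ (some μ)).toReal) ∧
    (∀ idi idj : (E n).ID, 1 - ε n ≤ ((E n).decReEncrypted idi idj μ (some μ)).toReal)

/-! ### The building blocks of the construction -/

/-- `k = ⌈log₂ q⌉`. -/
abbrev bitLen (q : ℕ) : ℕ := Nat.clog 2 q

/-- The `nk` column indices of the gadget matrix. -/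
abbrev GIdx (n q : ℕ) : Type := Fin n × Fin (bitLen q)

/-- The `m = m̄ + nk` column indices of the public matrix. -/
abbrev Idx (n q mbar : ℕ) : Type := Fin mbar ⊕ GIdx n q

/-- The `mk` row indices of the upper part of a re-encryption key. -/
abbrev BitIdx (n q mbar : ℕ) : Type := Idx n q mbar × Fin (bitLen q)

/-- The gadget matrix `G = I_n ⊗ (1, 2, …, 2^(k-1))`. -/
def gadget (n q : ℕ) : Matrix (Fin n) (GIdx n q) (ZMod q) :=
  Matrix.of fun i jl => if i = jl.1 then 2 ^ (jl.2 : ℕ) else 0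

/-- Reduction modulo `q` of an integer matrix. -/
abbrev modMat {ι κ : Type} (q : ℕ) (R : Matrix ι κ ℤ) : Matrix ι κ (ZMod q) :=
  R.map fun z : ℤ => (z : ZMod q)

/-- Reduction modulo `q` of an integer vector. -/
abbrev modVec {ι : Type} (q : ℕ) (x : ι → ℤ) : ι → ZMod q := fun i => (x i : ZMod q)

/-- Bit decomposition `BD`: the entry `(i, j)` is the bit `j` of the representative of `x i` in
`{0, …, q-1}`. -/
def BD {ι : Type} {q : ℕ} (x : ι → ZMod q) : ι × Fin (bitLen q) → ZMod q :=
  fun ij => if (x ij.1).val.testBit ij.2 then 1 else 0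

/-- Powers of two: the entry `(i, j)` of `P2 x` is `2^j * x i`. -/
def P2 {ι : Type} {q : ℕ} (x : ι → ZMod q) : ι × Fin (bitLen q) → ZMod q :=
  fun ij => 2 ^ (ij.2 : ℕ) * x ij.1

/-- The lattice coset `Λ_u^⊥(A) = {z ∈ ℤ^ι : A z = u mod q}`. -/
def latticeCoset {n q : ℕ} {ι : Type} [Fintype ι] (A : Matrix (Fin n) ι (ZMod q))
    (u : Fin n → ZMod q) : Set (ι → ℤ) :=
  {z | A *ᵥ modVec q z = u}

/-- The largest singular value of an integer matrix, as the operator norm for the Euclidean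
norms. -/
def s₁ {ι κ : Type} [Fintype ι] [Fintype κ] [DecidableEq κ] (R : Matrix ι κ ℤ) : ℝ :=
  ‖LinearMap.toContinuousLinearMap
    (Matrix.toEuclideanLin (R.map fun z : ℤ => (z : ℝ)))‖

/-- The public matrix `A = [Ā | -Ā R]`. -/
def publicMatrix {n q mbar : ℕ} (Abar : Matrix (Fin n) (Fin mbar) (ZMod q))
    (R : Matrix (Fin mbar) (GIdx n q) ℤ) : Matrix (Fin n) (Idx n q mbar) (ZMod q) :=
  Matrix.fromCols Abar (-(Abar * modMat q R))

/-- The matrix `A_id = A + [0 | H_id G]` of an identity with tag `H_id`; for `A = [Ā | -Ā R]` it is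
`[Ā | -Ā R + H_id G]`. -/
def idMatrix {n q mbar : ℕ} (A : Matrix (Fin n) (Idx n q mbar) (ZMod q))
    (Hid : Matrix (Fin n) (Fin n) (ZMod q)) : Matrix (Fin n) (Idx n q mbar) (ZMod q) :=
  A + Matrix.fromCols 0 (Hid * gadget n q)

/-- The Gaussian parameter of secret keys, `s = σ √(s₁(R)² + 1) r`. -/
def keyParam {n q mbar : ℕ} (σ r : ℝ) (R : Matrix (Fin mbar) (GIdx n q) ℤ) : ℝ :=
  σ * Real.sqrt (s₁ R ^ 2 + 1) * r

/-- The type of preimage samplers with a trapdoor: the inputs are the trapdoor `R`, the matrix `Ā`,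
the tag `H` and the syndrome `u`. -/
abbrev Sampler (n q mbar : ℕ) : Type :=
  Matrix (Fin mbar) (GIdx n q) ℤ → Matrix (Fin n) (Fin mbar) (ZMod q) →
    Matrix (Fin n) (Fin n) (ZMod q) → (Fin n → ZMod q) → PMF (Idx n q mbar → ℤ)

/-- For every trapdoor and every invertible tag, the output of the sampler is within statistical
distance `δ` of `D_{Λ_u^⊥(A), s}`, where `A = [Ā | -Ā R + H G]`. -/
def Sampler.IsClose {n q mbar : ℕ} (Samp : Sampler n q mbar) (σ r δ : ℝ) : Prop :=
  ∀ (R : Matrix (Fin mbar) (GIdx n q) ℤ) (Abar : Matrix (Fin n) (Fin mbar) (ZMod q))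
    (Hid : Matrix (Fin n) (Fin n) (ZMod q)) (u : Fin n → ZMod q), IsUnit Hid →
    statDist (Samp R Abar Hid u)
      (discreteGaussian (latticeCoset (idMatrix (publicMatrix Abar R) Hid) u)
        (keyParam σ r R)) ≤ δ

/-! ### The construction -/

/-- Encryption of `b` under the matrix `A_id` and the vector `u`. -/
def encrypt {n q mbar : ℕ} [NeZero q] (r α : ℝ) (Aid : Matrix (Fin n) (Idx n q mbar) (ZMod q))
    (u : Fin n → ZMod q) (b : Bool) : PMF ((Idx n q mbar → ZMod q) × ZMod q) :=
  (PMF.uniformOfFintype (Fin n → ZMod q)).bind fun s =>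
  (gaussianInt (α * q)).bind fun e =>
  (gaussianVec (Fin mbar) (α * q)).bind fun e₀ =>
  (gaussianVec (GIdx n q) (Real.sqrt ((sqNorm e₀ + mbar * (α * q) ^ 2) * r ^ 2))).bind fun e₁ =>
  PMF.pure (Aidᵀ *ᵥ s + modVec q (Sum.elim e₀ e₁),
    u ⬝ᵥ s + (e : ZMod q) + if b then ((q / 2 : ℕ) : ZMod q) else 0)

/-- Decryption: `0` if `b' = c₂ - xᵗ c₁` is closer to `0` than to `⌊q/2⌋` modulo `q`,
otherwise `1`. -/
def decrypt {n q mbar : ℕ} (x : Idx n q mbar → ℤ) (ct : (Idx n q mbar → ZMod q) × ZMod q) :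
    Bool :=
  let b' : ZMod q := ct.2 - modVec q x ⬝ᵥ ct.1
  if |b'.valMinAbs| < |(b' - ((q / 2 : ℕ) : ZMod q)).valMinAbs| then false else true

/-- Re-encryption keys, `(mk + 1) × (m + 1)` matrices over `ℤ_q`. -/
abbrev ReKey (n q mbar : ℕ) : Type :=
  Matrix (BitIdx n q mbar ⊕ Unit) (Idx n q mbar ⊕ Unit) (ZMod q)

/-- The re-encryption key `[r₁ A_j, r₁ u + r₂ - P2(x_i); 0, 1]`. -/
def reKey {n q mbar : ℕ} (r : ℝ) (Aj : Matrix (Fin n) (Idx n q mbar) (ZMod q))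
    (u : Fin n → ZMod q) (xi : Idx n q mbar → ℤ) : PMF (ReKey n q mbar) :=
  (gaussianMatrix (BitIdx n q mbar) (Fin n) r).bind fun r₁ =>
  (gaussianVec (BitIdx n q mbar) r).bind fun r₂ =>
  PMF.pure (Matrix.fromBlocks (modMat q r₁ * Aj)
    (Matrix.replicateCol Unit (modMat q r₁ *ᵥ u + modVec q r₂ - P2 (modVec q xi))) 0 1)

/-- Re-encryption: `[BD(c₁)ᵗ | c₂] · rk`. -/
def reEncrypt {n q mbar : ℕ} (rk : ReKey n q mbar) (ct : (Idx n q mbar → ZMod q) × ZMod q) :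
    (Idx n q mbar → ZMod q) × ZMod q :=
  let v := Sum.elim (BD ct.1) (fun _ : Unit => ct.2) ᵥ* rk
  (fun i => v (Sum.inl i), v (Sum.inr ()))

/-- The selectively secure scheme. Identities are the nonzero vectors of `ℤ_q^n`, and `H` is their
encoding by `n × n` matrices. The public parameters are `(A, u)`, the master secret key is `R`. -/
def selectiveScheme (n q mbar : ℕ) [NeZero q] (r α : ℝ)
    (H : (Fin n → ZMod q) → Matrix (Fin n) (Fin n) (ZMod q)) (Samp : Sampler n q mbar) :
    Scheme where
  PP := Matrix (Fin n) (Idx n q mbar) (ZMod q) × (Fin n → ZMod q)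
  MSK := Matrix (Fin mbar) (GIdx n q) ℤ
  ID := {id : Fin n → ZMod q // id ≠ 0}
  SK := Idx n q mbar → ℤ
  RK := ReKey n q mbar
  CT := (Idx n q mbar → ZMod q) × ZMod q
  Msg := Bool
  setup :=
    (PMF.uniformOfFintype (Fin n → Fin mbar → ZMod q)).bind fun Abar =>
    (gaussianMatrix (Fin mbar) (GIdx n q) r).bind fun R =>
    (PMF.uniformOfFintype (Fin n → ZMod q)).bind fun u =>
    PMF.pure ((publicMatrix (Matrix.of Abar) R, u), R)
  extract pp R id := Samp R pp.1.toCols₁ (H id) pp.2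
  reKeyGen pp x _ idj := reKey r (idMatrix pp.1 (H idj)) pp.2 x
  enc pp id b := encrypt r α (idMatrix pp.1 (H id)) pp.2 b
  reEnc _ rk ct := PMF.pure (reEncrypt rk ct)
  dec _ x ct := some (decrypt x ct)

end IBPRE

end

/-!
Correctness comes down to showing that the decryption noise stays below `q / 16`. For a key `x` with
`A_id x = u` the noise of a fresh ciphertext is `e - ⟨x₀, e₀⟩ - ⟨x₁, e₁⟩`, and re-encryption turns
it into a ciphertext for the other identity whose noise is larger by `⟨BD(c₁), r₂⟩`: the products
with `r₁` cancel because `A_j x_j = u`, and `BD(c₁) · P2(x_i) = ⟨x_i, c₁⟩`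
(`hasNoise_encryption`, `hasNoise_reEncrypt`, `decrypt_eq_of_hasNoise`).

Write `N = n k`. Three facts on discrete Gaussians bound the noise.

* A linear functional `⟨a, x⟩` of a Gaussian vector of width `s` exceeds `B` with probability at
  most `exp (-π B² / (s² ‖a‖²))`, for every width (`gaussianVec_le_dotProduct`). The reason is that
  a shifted Gaussian sum over `ℤ` is at most the centred one, by Poisson summation.
* The Gaussian matrix `R` has largest singular value `O(r √N)`
  (`exists_gaussianMatrix_s₁_tail`), by a union bound over a net of scaled integer vectors.
* A Gaussian on a lattice coset of dimension `m` and of width `s` has norm `O(s √m)`, provided that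
  the coset contains a vector of comparable norm (`exists_isNormTailConstant`). No smoothing
  parameter is needed: a factor exponential in `m` is affordable, so it is enough to compare the
  cells of a cubical grid of side `s` with one cell around a short vector. The trapdoor provides the
  short vector `(R w, w)`, where `w` is the bit decomposition of `H⁻¹ u`
  (`exists_short_mem_latticeCoset`).

Together these give `‖x‖ = O(r² N)` and `‖e₀‖ = O(α q √N)`, so `e₁` has width `O(α q r √N)`. As
`e₁` is drawn independently of `x`, the product `⟨x₁, e₁⟩` reaches `q / 64` with probability at most
`2 exp (-κ N / r²)` for some `κ > 0` as soon as `1 / α ≥ N² r²`; the remaining terms are no worse,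
the one of re-encryption because `q ≥ N^(3/2) r` (`exists_noise_parameters`). Since `r = o(√n)` and
`k ≥ log n`, the exponent `κ N / r²` grows faster than `log n`, and the failure probability is
negligible. The constants `c` and `σ` only influence `κ`, so that `C = 1` is sufficient.
-/

namespace IBPRE

/-! ### Failure probabilities of composed experiments -/

/-- Union bound for a sequential experiment: if the first stage is bad with probability at most `a`
and every good outcome makes the second stage fail with probability at most `b`, then the whole
experiment fails with probability at most `a + b`. -/
lemma toOuterMeasure_bind_le {α β : Type*} (p : PMF α) (f : α → PMF β) (S : Set β) (B : Set α)
    {a b : ENNReal} (ha : p.toOuterMeasure B ≤ a)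
    (hb : ∀ x, x ∉ B → (f x).toOuterMeasure S ≤ b) :
    (p.bind f).toOuterMeasure S ≤ a + b := by
  classical
  rw [PMF.toOuterMeasure_bind_apply]
  calc ∑' x, p x * (f x).toOuterMeasure S
      ≤ ∑' x, (B.indicator p x + p x * b) := by
        refine ENNReal.tsum_le_tsum fun x => ?_
        by_cases hx : x ∈ B
        · rw [Set.indicator_of_mem hx]
          refine le_add_right (mul_le_of_le_one_right' ?_)
          rw [PMF.toOuterMeasure_apply, ← (f x).tsum_coe]
          exact ENNReal.tsum_le_tsum fun y => Set.indicator_le_self _ _ y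
        · exact le_add_left (mul_le_mul_right (hb x hx) (p x))
    _ = p.toOuterMeasure B + b := by
        rw [ENNReal.tsum_add, ENNReal.tsum_mul_right, p.tsum_coe, one_mul,
          PMF.toOuterMeasure_apply]
    _ ≤ a + b := by gcongr

lemma toOuterMeasure_bind_le_of_forall {α β : Type*} (p : PMF α) (f : α → PMF β) (S : Set β)
    {b : ENNReal} (hb : ∀ x, (f x).toOuterMeasure S ≤ b) : (p.bind f).toOuterMeasure S ≤ b := by
  have := toOuterMeasure_bind_le p f S ∅ (a := 0) (b := b) (by simp) (fun x _ => hb x)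
  simpa using this

lemma toOuterMeasure_pure_eq_zero {α : Type*} {a : α} {S : Set α} (h : a ∉ S) :
    (PMF.pure a).toOuterMeasure S = 0 := by
  classical
  rw [PMF.toOuterMeasure_pure_apply, if_neg h]

lemma one_sub_le_toReal_of_compl {α : Type*} (p : PMF α) (a : α) {ε : ℝ} (hε : 0 ≤ ε)
    (h : p.toOuterMeasure {a}ᶜ ≤ ENNReal.ofReal ε) : 1 - ε ≤ (p a).toReal := by
  classical
  have h1 : p.toOuterMeasure {a} + p.toOuterMeasure {a}ᶜ = 1 := by
    rw [PMF.toOuterMeasure_apply, PMF.toOuterMeasure_apply, ← ENNReal.tsum_add, ← p.tsum_coe]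
    exact tsum_congr fun x => congrFun (Set.indicator_self_add_compl {a} p) x
  rw [PMF.toOuterMeasure_apply_singleton] at h1
  have h2 : (1 : ENNReal) ≤ p a + ENNReal.ofReal ε := h1 ▸ by gcongr
  have h3 := ENNReal.toReal_mono (by finiteness [p.apply_ne_top a]) h2
  rw [ENNReal.toReal_add (p.apply_ne_top a) ENNReal.ofReal_ne_top, ENNReal.toReal_ofReal hε,
    ENNReal.toReal_one] at h3
  linarith

lemma statDist_nonneg {Ω : Type} (P Q : PMF Ω) : 0 ≤ statDist P Q :=
  mul_nonneg (by norm_num) (tsum_nonneg fun _ => abs_nonneg _)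

lemma toOuterMeasure_le_add_statDist {Ω : Type} (P Q : PMF Ω) (S : Set Ω) :
    P.toOuterMeasure S ≤ Q.toOuterMeasure S + ENNReal.ofReal (2 * statDist P Q) := by
  classical
  have hs (R : PMF Ω) : Summable fun w => (R w).toReal :=
    ENNReal.summable_toReal (by rw [R.tsum_coe]; exact ENNReal.one_ne_top)
  have habs : Summable fun w => |(P w).toReal - (Q w).toReal| := ((hs P).sub (hs Q)).abs
  have h2 : 2 * statDist P Q = ∑' w, |(P w).toReal - (Q w).toReal| := by
    rw [statDist]; ring
  rw [h2, ENNReal.ofReal_tsum_of_nonneg (fun _ => abs_nonneg _) habs,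
    PMF.toOuterMeasure_apply, PMF.toOuterMeasure_apply, ← ENNReal.tsum_add]
  refine ENNReal.tsum_le_tsum fun w => ?_
  by_cases hw : w ∈ S
  · rw [Set.indicator_of_mem hw, Set.indicator_of_mem hw]
    nth_rw 1 [← ENNReal.ofReal_toReal (P.apply_ne_top w),
      ← ENNReal.ofReal_toReal (Q.apply_ne_top w)]
    rw [← ENNReal.ofReal_add ENNReal.toReal_nonneg (abs_nonneg _)]
    exact ENNReal.ofReal_le_ofReal (by linarith [le_abs_self ((P w).toReal - (Q w).toReal)])
  · simp [hw]

/-! ### Gaussian sums over the integers -/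

lemma summable_exp_neg_mul_int_sq {a : ℝ} (ha : 0 < a) :
    Summable fun n : ℤ => Real.exp (-a * (n : ℝ) ^ 2) := by
  have hnat : Summable fun n : ℕ => Real.exp (-a * (n : ℝ) ^ 2) := by
    have hg : Summable fun n : ℕ => Real.exp (-a) ^ n :=
      summable_geometric_of_lt_one (Real.exp_pos _).le (by
        rw [← Real.exp_zero]; exact Real.exp_lt_exp.2 (by linarith))
    refine Summable.of_nonneg_of_le (fun n => (Real.exp_pos _).le) (fun n => ?_) hg
    rw [← Real.exp_nat_mul]
    refine Real.exp_le_exp.2 ?_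
    have : (n : ℝ) ≤ (n : ℝ) ^ 2 := by exact_mod_cast Nat.le_self_pow two_ne_zero n
    nlinarith
  refine Summable.of_nat_of_neg ?_ ?_
  · simpa using hnat
  · simpa using hnat

lemma summable_exp_neg_mul_int_sub_sq {a : ℝ} (ha : 0 < a) (t : ℝ) :
    Summable fun n : ℤ => Real.exp (-a * ((n : ℝ) - t) ^ 2) := by
  refine Summable.of_nonneg_of_le (fun n => (Real.exp_pos _).le) (fun n => ?_)
    ((summable_exp_neg_mul_int_sq (half_pos ha)).mul_left (Real.exp (a * t ^ 2)))
  rw [← Real.exp_add]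
  refine Real.exp_le_exp.2 ?_
  nlinarith [sq_nonneg ((n : ℝ) - 2 * t)]

/-- A shifted Gaussian sum over `ℤ` is at most the centred one: by Poisson summation the shift only
multiplies the nonnegative dual terms by phases. -/
lemma tsum_exp_neg_mul_int_sub_sq_le {a : ℝ} (ha : 0 < a) (t : ℝ) :
    ∑' n : ℤ, Real.exp (-(Real.pi / a) * ((n : ℝ) - t) ^ 2) ≤
      ∑' n : ℤ, Real.exp (-(Real.pi / a) * (n : ℝ) ^ 2) := by
  have hre : 0 < ((a : ℂ)).re := by simpa using ha
  have hc : (1 / (a : ℂ) ^ (1 / 2 : ℂ)) = ((1 / a ^ (1 / 2 : ℝ) : ℝ) : ℂ) := by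
    rw [Complex.ofReal_div, Complex.ofReal_cpow ha.le]; simp
  have hpos : 0 < 1 / a ^ (1 / 2 : ℝ) := by positivity
  have key (u : ℝ) : ∑' n : ℤ, Complex.exp (-Real.pi * a * (n : ℂ) ^ 2 +
      2 * Real.pi * (Complex.I * u) * n) = ((1 / a ^ (1 / 2 : ℝ) *
        ∑' n : ℤ, Real.exp (-(Real.pi / a) * ((n : ℝ) - u) ^ 2) : ℝ) : ℂ) := by
    rw [Complex.tsum_exp_neg_quadratic hre, hc, Complex.ofReal_mul, Complex.ofReal_tsum]
    congr 1
    refine tsum_congr fun n => ?_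
    rw [Complex.ofReal_exp]
    congr 1
    push_cast
    rw [← mul_assoc, Complex.I_mul_I]
    ring
  have hn (u : ℝ) (n : ℤ) : ‖Complex.exp (-Real.pi * a * (n : ℂ) ^ 2 +
      2 * Real.pi * (Complex.I * u) * n)‖ = Real.exp (-(Real.pi * a) * (n : ℝ) ^ 2) := by
    rw [Complex.norm_exp]
    congr 1
    have : (-Real.pi * a * (n : ℂ) ^ 2 + 2 * Real.pi * (Complex.I * u) * n) =
      ((-(Real.pi * a) * (n : ℝ) ^ 2 : ℝ) : ℂ) + ((2 * Real.pi * u * n : ℝ) : ℂ) * Complex.I := by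
      push_cast; ring
    rw [this]
    simp only [Complex.add_re, Complex.ofReal_re, Complex.re_ofReal_mul, Complex.I_re, mul_zero,
      add_zero]
  have hsum := summable_exp_neg_mul_int_sq (mul_pos Real.pi_pos ha)
  have h1 : 1 / a ^ (1 / 2 : ℝ) * ∑' n : ℤ, Real.exp (-(Real.pi / a) * ((n : ℝ) - t) ^ 2) ≤
      ∑' n : ℤ, Real.exp (-(Real.pi * a) * (n : ℝ) ^ 2) := by
    refine (le_abs_self _).trans ?_
    rw [← Real.norm_eq_abs, ← Complex.norm_real, ← key t]
    refine (norm_tsum_le_tsum_norm ?_).trans_eq (tsum_congr (hn t))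
    simpa only [hn] using hsum
  have h2 : ∑' n : ℤ, Real.exp (-(Real.pi * a) * (n : ℝ) ^ 2) =
      1 / a ^ (1 / 2 : ℝ) * ∑' n : ℤ, Real.exp (-(Real.pi / a) * (n : ℝ) ^ 2) := by
    have := key 0
    simp only [sub_zero] at this
    rw [← Complex.ofReal_inj, ← this, Complex.ofReal_tsum]
    refine tsum_congr fun n => ?_
    push_cast
    congr 1
    simp
  rw [h2] at h1
  exact le_of_mul_le_mul_left h1 hpos

/-- A sum of products over `ℤ^ι` is the product of the sums over the coordinates. -/
lemma tsum_prod_pi (ι : Type) [Fintype ι] :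
    ∀ f : ι → ℤ → ENNReal, ∑' x : ι → ℤ, ∏ i, f i (x i) = ∏ i, ∑' n, f i n := by
  refine Fintype.induction_empty_option (P := fun ι _ => ∀ f : ι → ℤ → ENNReal,
    ∑' x : ι → ℤ, ∏ i, f i (x i) = ∏ i, ∑' n, f i n) ?_ ?_ ?_ ι
  · intro α β _ e ih f
    let _ := Fintype.ofEquiv β e.symm
    have h := ih fun i => f (e i)
    rw [← (Equiv.arrowCongr e (Equiv.refl ℤ)).tsum_eq, ← e.prod_comp, ← h]
    refine tsum_congr fun x => ?_
    rw [← e.prod_comp]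
    simp
  · intro f
    simp
  · intro α _ ih f
    rw [← (Equiv.piOptionEquivProd (β := fun _ => ℤ)).symm.tsum_eq]
    simp only [Fintype.prod_option, Equiv.piOptionEquivProd, Equiv.coe_fn_symm_mk]
    rw [ENNReal.tsum_prod (f := fun (a : ℤ) (b : α → ℤ) => f none a * ∏ i, f (some i) (b i))]
    simp_rw [ENNReal.tsum_mul_left, ih fun i => f (some i), ENNReal.tsum_mul_right]

/-! ### Tail bounds for discrete Gaussians -/

lemma sqNorm_nonneg {ι : Type} [Fintype ι] (x : ι → ℤ) : 0 ≤ sqNorm x :=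
  Finset.sum_nonneg fun _ _ => sq_nonneg _

lemma gaussianWeight_of_mem {ι : Type} [Fintype ι] {S : Set (ι → ℤ)} {x : ι → ℤ} (hx : x ∈ S)
    (s : ℝ) : gaussianWeight S s x = ENNReal.ofReal (Real.exp (-Real.pi * sqNorm x / s ^ 2)) :=
  Set.indicator_of_mem hx _

lemma gaussianWeight_univ {ι : Type} [Fintype ι] (s : ℝ) (x : ι → ℤ) :
    gaussianWeight Set.univ s x =
      ∏ i, ENNReal.ofReal (Real.exp (-(Real.pi / s ^ 2) * (x i : ℝ) ^ 2)) := by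
  rw [gaussianWeight_of_mem (Set.mem_univ x),
    ← ENNReal.ofReal_prod_of_nonneg fun _ _ => (Real.exp_pos _).le, ← Real.exp_sum,
    ← Finset.mul_sum, sqNorm]
  congr 2
  ring

lemma tsum_gaussianWeight_ne_top {ι : Type} [Fintype ι] (S : Set (ι → ℤ)) {s : ℝ} (hs : 0 < s) :
    ∑' x, gaussianWeight S s x ≠ ⊤ := by
  have h1 : ∑' x : ι → ℤ, gaussianWeight Set.univ s x ≠ ⊤ := by
    simp_rw [gaussianWeight_univ]
    rw [tsum_prod_pi ι fun _ n => ENNReal.ofReal (Real.exp (-(Real.pi / s ^ 2) * (n : ℝ) ^ 2))]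
    refine ENNReal.prod_ne_top fun _ _ => ?_
    rw [← ENNReal.ofReal_tsum_of_nonneg (fun _ => (Real.exp_pos _).le)
      (summable_exp_neg_mul_int_sq (by positivity))]
    exact ENNReal.ofReal_ne_top
  refine ne_top_of_le_ne_top h1 (ENNReal.tsum_le_tsum fun x => ?_)
  exact Set.indicator_le_indicator_of_subset (Set.subset_univ _) (fun _ => zero_le) x

lemma tsum_gaussianWeight_ne_zero {ι : Type} [Fintype ι] {S : Set (ι → ℤ)} (hS : S.Nonempty)
    (s : ℝ) : ∑' x, gaussianWeight S s x ≠ 0 := by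
  obtain ⟨x, hx⟩ := hS
  intro h
  have := ENNReal.tsum_eq_zero.1 h x
  rw [gaussianWeight_of_mem hx] at this
  exact absurd (ENNReal.ofReal_eq_zero.1 this) (not_le.2 (Real.exp_pos _))

/-- A Gaussian probability is at most `c` as soon as the weight of the event is at most `c` times
the total weight. -/
lemma discreteGaussian_toOuterMeasure_le {ι : Type} [Fintype ι] {S : Set (ι → ℤ)}
    (hS : S.Nonempty) {s : ℝ} (hs : 0 < s) (B : Set (ι → ℤ)) {c : ENNReal}
    (h : ∑' x, B.indicator (gaussianWeight S s) x ≤ c * ∑' x, gaussianWeight S s x) :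
    (discreteGaussian S s).toOuterMeasure B ≤ c := by
  classical
  have h0 := tsum_gaussianWeight_ne_zero hS s
  have ht := tsum_gaussianWeight_ne_top S hs
  rw [discreteGaussian, dif_pos ⟨h0, ht⟩, PMF.toOuterMeasure_apply]
  have : ∀ x, B.indicator (PMF.normalize (gaussianWeight S s) h0 ht) x =
      B.indicator (gaussianWeight S s) x * (∑' x, gaussianWeight S s x)⁻¹ := by
    intro x
    by_cases hx : x ∈ B
    · simp [hx, PMF.normalize_apply]
    · simp [hx]
  rw [tsum_congr this, ENNReal.tsum_mul_right, ← div_eq_mul_inv]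
  exact ENNReal.div_le_of_le_mul h

lemma discreteGaussian_toOuterMeasure_compl {ι : Type} [Fintype ι] {S : Set (ι → ℤ)}
    (hS : S.Nonempty) {s : ℝ} (hs : 0 < s) : (discreteGaussian S s).toOuterMeasure Sᶜ = 0 := by
  refine le_antisymm (discreteGaussian_toOuterMeasure_le hS hs _ ?_) zero_le
  rw [zero_mul, nonpos_iff_eq_zero, ENNReal.tsum_eq_zero]
  intro x
  by_cases hx : x ∈ S <;> simp [gaussianWeight, hx]

/-- A linear functional of a Gaussian integer vector is sub-Gaussian, in every dimension and for
every width. -/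
lemma gaussianVec_le_dotProduct {ι : Type} [Fintype ι] {s : ℝ} (hs : 0 < s) (a : ι → ℝ) {V B : ℝ}
    (hV : 0 < V) (hB : 0 ≤ B) (ha : ∑ i, a i ^ 2 ≤ V) :
    (gaussianVec ι s).toOuterMeasure {x | B ≤ ∑ i, a i * x i} ≤
      ENNReal.ofReal (Real.exp (-(Real.pi * B ^ 2 / (s ^ 2 * V)))) := by
  have hs2 : 0 < s ^ 2 := by positivity
  -- the exponential moment is taken at the point that optimizes the Chernoff bound
  set l : ℝ := B / V with hl
  refine discreteGaussian_toOuterMeasure_le ⟨0, Set.mem_univ _⟩ hs _ ?_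
  have hpt (x : ι → ℤ) : {x : ι → ℤ | B ≤ ∑ i, a i * x i}.indicator
      (gaussianWeight Set.univ s) x ≤
      ENNReal.ofReal (Real.exp (-(Real.pi * B ^ 2 / (s ^ 2 * V)))) *
        ∏ i, ENNReal.ofReal (Real.exp (-(Real.pi / s ^ 2) * ((x i : ℝ) - l * a i) ^ 2)) := by
    refine Set.indicator_apply_le' (fun hx => ?_) fun _ => zero_le
    rw [gaussianWeight_of_mem (Set.mem_univ x),
      ← ENNReal.ofReal_prod_of_nonneg fun _ _ => (Real.exp_pos _).le, ← Real.exp_sum,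
      ← ENNReal.ofReal_mul (Real.exp_pos _).le, ← Real.exp_add, ← Finset.mul_sum]
    refine ENNReal.ofReal_le_ofReal (Real.exp_le_exp.2 ?_)
    have hx' : B ≤ ∑ i, a i * x i := hx
    have hsq : ∑ i, ((x i : ℝ) - l * a i) ^ 2 =
        sqNorm x - 2 * l * ∑ i, a i * x i + l ^ 2 * ∑ i, a i ^ 2 := by
      rw [sqNorm, Finset.mul_sum, Finset.mul_sum, ← Finset.sum_sub_distrib,
        ← Finset.sum_add_distrib]
      exact Finset.sum_congr rfl fun i _ => by ring
    have hl0 : 0 ≤ l := div_nonneg hB hV.le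
    have hlV : l * V = B := div_mul_cancel₀ _ hV.ne'
    have hb : ∑ i, ((x i : ℝ) - l * a i) ^ 2 ≤ sqNorm x - l * B := by
      rw [hsq]
      have h1 : l * B ≤ l * ∑ i, a i * x i := mul_le_mul_of_nonneg_left hx' hl0
      have h2 : l ^ 2 * ∑ i, a i ^ 2 ≤ l ^ 2 * V := mul_le_mul_of_nonneg_left ha (sq_nonneg l)
      have h3 : l ^ 2 * V = l * B := by rw [← hlV]; ring
      linarith
    have h4 : Real.pi * B ^ 2 / (s ^ 2 * V) = Real.pi / s ^ 2 * (l * B) := by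
      rw [hl]; field_simp
    have h5 := mul_le_mul_of_nonneg_left hb (div_pos Real.pi_pos hs2).le
    have h6 : -Real.pi * sqNorm x / s ^ 2 = -(Real.pi / s ^ 2 * sqNorm x) := by ring
    rw [h4, h6]
    linarith
  refine (ENNReal.tsum_le_tsum hpt).trans ?_
  rw [ENNReal.tsum_mul_left]
  refine mul_le_mul_right ?_ _
  simp_rw [gaussianWeight_univ]
  rw [tsum_prod_pi ι fun i n =>
      ENNReal.ofReal (Real.exp (-(Real.pi / s ^ 2) * ((n : ℝ) - l * a i) ^ 2)),
    tsum_prod_pi ι fun _ n => ENNReal.ofReal (Real.exp (-(Real.pi / s ^ 2) * (n : ℝ) ^ 2))]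
  refine Finset.prod_le_prod' fun i _ => ?_
  have hpi : 0 < Real.pi / s ^ 2 := by positivity
  rw [← ENNReal.ofReal_tsum_of_nonneg (fun _ => (Real.exp_pos _).le)
      (summable_exp_neg_mul_int_sub_sq hpi _),
    ← ENNReal.ofReal_tsum_of_nonneg (fun _ => (Real.exp_pos _).le)
      (summable_exp_neg_mul_int_sq hpi)]
  exact ENNReal.ofReal_le_ofReal (tsum_exp_neg_mul_int_sub_sq_le hs2 _)

lemma gaussianVec_le_abs_dotProduct {ι : Type} [Fintype ι] {s : ℝ} (hs : 0 < s) (a : ι → ℝ)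
    {V B : ℝ} (hV : 0 < V) (hB : 0 ≤ B) (ha : ∑ i, a i ^ 2 ≤ V) :
    (gaussianVec ι s).toOuterMeasure {x | B ≤ |∑ i, a i * x i|} ≤
      ENNReal.ofReal (2 * Real.exp (-(Real.pi * B ^ 2 / (s ^ 2 * V)))) := by
  have h1 := gaussianVec_le_dotProduct (B := B) hs a hV hB ha
  have h2 := gaussianVec_le_dotProduct (B := B) hs (fun i => -a i) hV hB (by simpa using ha)
  have hsub : {x : ι → ℤ | B ≤ |∑ i, a i * x i|} ⊆
      {x | B ≤ ∑ i, a i * x i} ∪ {x | B ≤ ∑ i, -a i * x i} := by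
    intro x hx
    have hx' : B ≤ |∑ i, a i * (x i : ℝ)| := hx
    rcases le_abs.1 hx' with h | h
    · exact Or.inl h
    · exact Or.inr (by simpa [Finset.sum_neg_distrib] using h)
  calc _ ≤ _ := MeasureTheory.measure_mono hsub
    _ ≤ _ := MeasureTheory.measure_union_le _ _
    _ ≤ _ := add_le_add h1 h2
    _ = _ := by rw [← ENNReal.ofReal_add (Real.exp_pos _).le (Real.exp_pos _).le, two_mul]

lemma gaussianInt_le_abs {s B : ℝ} (hs : 0 < s) (hB : 0 ≤ B) :
    (gaussianInt s).toOuterMeasure {x | B ≤ |(x : ℝ)|} ≤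
      ENNReal.ofReal (2 * Real.exp (-(Real.pi * B ^ 2 / s ^ 2))) := by
  rw [gaussianInt, PMF.toOuterMeasure_map_apply]
  simpa using
    gaussianVec_le_abs_dotProduct (ι := Unit) (B := B) hs (fun _ => 1) one_pos hB (by simp)

lemma exists_tsum_gaussian_le_exp {a : ℝ} (ha : 0 < a) :
    ∃ b : ℝ, 0 < b ∧ ∑' n : ℤ, ENNReal.ofReal (Real.exp (-a * (n : ℝ) ^ 2)) ≤
      ENNReal.ofReal (Real.exp b) := by
  refine ⟨|∑' n : ℤ, Real.exp (-a * (n : ℝ) ^ 2)| + 1, by positivity, ?_⟩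
  rw [← ENNReal.ofReal_tsum_of_nonneg (fun _ => (Real.exp_pos _).le)
    (summable_exp_neg_mul_int_sq ha)]
  refine ENNReal.ofReal_le_ofReal ((le_abs_self _).trans ?_)
  linarith [Real.add_one_le_exp (|∑' n : ℤ, Real.exp (-a * (n : ℝ) ^ 2)| + 1)]

lemma tsum_prod_gaussian_le {ι : Type} [Fintype ι] {a b : ℝ}
    (h : ∑' n : ℤ, ENNReal.ofReal (Real.exp (-a * (n : ℝ) ^ 2)) ≤ ENNReal.ofReal (Real.exp b)) :
    ∑' z : ι → ℤ, ENNReal.ofReal (Real.exp (-a * sqNorm z)) ≤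
      ENNReal.ofReal (Real.exp (b * Fintype.card ι)) := by
  have hz (z : ι → ℤ) : ENNReal.ofReal (Real.exp (-a * sqNorm z)) =
      ∏ i, ENNReal.ofReal (Real.exp (-a * (z i : ℝ) ^ 2)) := by
    rw [← ENNReal.ofReal_prod_of_nonneg fun _ _ => (Real.exp_pos _).le, ← Real.exp_sum,
      ← Finset.mul_sum, sqNorm]
  simp_rw [hz]
  rw [tsum_prod_pi ι fun _ n => ENNReal.ofReal (Real.exp (-a * (n : ℝ) ^ 2)), Finset.prod_const,
    Finset.card_univ, mul_comm, Real.exp_nat_mul, ENNReal.ofReal_pow (Real.exp_pos _).le]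
  gcongr

/-- The number of points of a coset `S` in one cell of side `s` is bounded by the Gaussian weight of
`S`, up to a factor that depends on the dimension and on `c₀`: translating the cell to a fixed point
`c₀` of `S` keeps its points inside `S`, at places of not too small weight. -/
lemma tsum_indicator_cell_le {ι : Type} [Fintype ι] {S : Set (ι → ℤ)} {c₀ : ι → ℤ}
    (hS : ∀ x ∈ S, ∀ y ∈ S, c₀ + x - y ∈ S) {s : ℝ} (hs : 0 < s) (F : Set (ι → ℤ))
    (hF : ∀ x ∈ F, ∀ y ∈ F, ∀ i, |(x i : ℝ) - y i| ≤ s) :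
    ∑' x : F, S.indicator (fun _ => (1 : ENNReal)) (x : ι → ℤ) ≤
      ENNReal.ofReal (Real.exp (2 * Real.pi * Fintype.card ι +
        2 * Real.pi * sqNorm c₀ / s ^ 2)) * ∑' x, gaussianWeight S s x := by
  have hs2 : 0 < s ^ 2 := by positivity
  by_cases hex : ∃ x₀ ∈ F, x₀ ∈ S
  · obtain ⟨x₀, hx₀F, hx₀S⟩ := hex
    have hpt (x : F) : S.indicator (fun _ => (1 : ENNReal)) (x : ι → ℤ) ≤
        ENNReal.ofReal (Real.exp (2 * Real.pi * Fintype.card ι +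
          2 * Real.pi * sqNorm c₀ / s ^ 2)) * gaussianWeight S s (c₀ + (x : ι → ℤ) - x₀) := by
      refine Set.indicator_apply_le' (fun hx => ?_) fun _ => zero_le
      rw [gaussianWeight_of_mem (hS _ hx _ hx₀S), ← ENNReal.ofReal_mul (Real.exp_pos _).le,
        ← Real.exp_add, ENNReal.one_le_ofReal, Real.one_le_exp_iff]
      have h1 : sqNorm (c₀ + (x : ι → ℤ) - x₀) ≤ 2 * sqNorm c₀ + 2 * (Fintype.card ι * s ^ 2) := by
        have : ∑ i : ι, s ^ 2 = Fintype.card ι * s ^ 2 := by simp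
        rw [← this, sqNorm, sqNorm, Finset.mul_sum, Finset.mul_sum, ← Finset.sum_add_distrib]
        refine Finset.sum_le_sum fun i _ => ?_
        have h2 := sq_le_sq' (neg_le_of_abs_le (hF x x.2 x₀ hx₀F i))
          (le_of_abs_le (hF x x.2 x₀ hx₀F i))
        simp only [Pi.add_apply, Pi.sub_apply]
        push_cast
        nlinarith [sq_nonneg ((c₀ i : ℝ) - ((x : ι → ℤ) i - x₀ i))]
      have h3 := mul_le_mul_of_nonneg_left h1 (div_pos Real.pi_pos hs2).le
      have h4 : Real.pi / s ^ 2 * (2 * sqNorm c₀ + 2 * (Fintype.card ι * s ^ 2)) =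
          2 * Real.pi * Fintype.card ι + 2 * Real.pi * sqNorm c₀ / s ^ 2 := by
        field_simp; ring
      have h5 : -Real.pi * sqNorm (c₀ + (x : ι → ℤ) - x₀) / s ^ 2 =
          -(Real.pi / s ^ 2 * sqNorm (c₀ + (x : ι → ℤ) - x₀)) := by ring
      rw [h5]
      linarith
    refine (ENNReal.tsum_le_tsum hpt).trans ?_
    rw [ENNReal.tsum_mul_left]
    refine mul_le_mul_right ?_ _
    refine ENNReal.tsum_comp_le_tsum_of_injective (f := fun x : F => c₀ + (x : ι → ℤ) - x₀) ?_ _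
    intro x y hxy
    exact Subtype.ext (add_left_cancel (sub_left_injective hxy))
  · have : ∀ x : F, S.indicator (fun _ => (1 : ENNReal)) (x : ι → ℤ) = 0 := fun x =>
      Set.indicator_of_notMem (fun hx => hex ⟨x, x.2, hx⟩) _
    simp [this]

/-- `K` is an admissible constant in the norm tail of the discrete Gaussian on a coset `S` of a
lattice. The bound is asked for every width `s`: the price for a small width is the Gaussian weight
of a vector `c₀` of the coset. -/
def IsNormTailConstant (K : ℝ) : Prop :=
  ∀ (ι : Type) [Fintype ι] (S : Set (ι → ℤ)) (c₀ : ι → ℤ), c₀ ∈ S →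
    (∀ x ∈ S, ∀ y ∈ S, c₀ + x - y ∈ S) → ∀ s : ℝ, 0 < s → ∀ T : ℝ,
    (discreteGaussian S s).toOuterMeasure {x | T ≤ sqNorm x} ≤
      ENNReal.ofReal (Real.exp (-(Real.pi * T / (2 * s ^ 2)) + K * Fintype.card ι +
        2 * Real.pi * sqNorm c₀ / s ^ 2))

/-- A discrete Gaussian of any width on any coset has its mass on vectors of norm `O(s √m)`, up to
the weight of a short vector of the coset. Covering space by cells of side `s` replaces the
smoothing parameter of the lattice. -/
lemma exists_isNormTailConstant : ∃ K : ℝ, 0 < K ∧ IsNormTailConstant K := by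
  have hpi := Real.pi_pos
  obtain ⟨b, hb, hsum⟩ := exists_tsum_gaussian_le_exp (a := Real.pi / 4) (by positivity)
  refine ⟨b + Real.pi / 8 + 2 * Real.pi, by positivity, ?_⟩
  intro ι _ S c₀ hc₀ hS s hs T
  have hs2 : 0 < s ^ 2 := by positivity
  set m : ℝ := ((Fintype.card ι : ℕ) : ℝ) with hm
  refine discreteGaussian_toOuterMeasure_le ⟨c₀, hc₀⟩ hs _ ?_
  set W := ∑' x, gaussianWeight S s x with hW
  -- half of the exponent pays for the tail, the other half is summed over the whole coset
  have hpt (x : ι → ℤ) : {x : ι → ℤ | T ≤ sqNorm x}.indicator (gaussianWeight S s) x ≤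
      ENNReal.ofReal (Real.exp (-(Real.pi * T / (2 * s ^ 2)))) *
        S.indicator (fun x => ENNReal.ofReal (Real.exp (-(Real.pi / (2 * s ^ 2)) * sqNorm x)))
          x := by
    refine Set.indicator_apply_le' (fun hx => ?_) fun _ => zero_le
    by_cases hxS : x ∈ S
    · rw [gaussianWeight_of_mem hxS, Set.indicator_of_mem hxS,
        ← ENNReal.ofReal_mul (Real.exp_pos _).le, ← Real.exp_add]
      refine ENNReal.ofReal_le_ofReal (Real.exp_le_exp.2 ?_)
      have hx' : T ≤ sqNorm x := hx
      have h1 := mul_le_mul_of_nonneg_left hx' (div_pos hpi (mul_pos two_pos hs2)).le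
      have h2 : -Real.pi * sqNorm x / s ^ 2 = -(Real.pi / (2 * s ^ 2) * sqNorm x) +
        -(Real.pi / (2 * s ^ 2)) * sqNorm x := by field_simp; ring
      have h3 : Real.pi * T / (2 * s ^ 2) = Real.pi / (2 * s ^ 2) * T := by ring
      rw [h2, h3]
      linarith
    · simp [gaussianWeight, hxS]
  refine (ENNReal.tsum_le_tsum hpt).trans ?_
  rw [ENNReal.tsum_mul_left]
  let g : (ι → ℤ) → (ι → ℤ) := fun x i => round ((x i : ℝ) / s)
  have hround (x : ι → ℤ) (i : ι) : |(x i : ℝ) - s * g x i| ≤ s / 2 := by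
    have h := abs_sub_round ((x i : ℝ) / s)
    have h1 : (x i : ℝ) - s * g x i = s * ((x i : ℝ) / s - round ((x i : ℝ) / s)) := by
      simp only [g]; field_simp
    rw [h1, abs_mul, abs_of_pos hs]
    nlinarith
  have hcell (z : ι → ℤ) : ∑' x : (g ⁻¹' {z} : Set (ι → ℤ)),
      S.indicator (fun x => ENNReal.ofReal (Real.exp (-(Real.pi / (2 * s ^ 2)) * sqNorm x)))
        (x : ι → ℤ) ≤
      ENNReal.ofReal (Real.exp (Real.pi / 8 * m)) *
        ENNReal.ofReal (Real.exp (-(Real.pi / 4) * sqNorm z)) *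
        (ENNReal.ofReal (Real.exp (2 * Real.pi * m + 2 * Real.pi * sqNorm c₀ / s ^ 2)) * W) := by
    have hF := tsum_indicator_cell_le hS hs (g ⁻¹' {z}) (by
      intro x hx y hy i
      have hx' : g x i = z i := congrFun hx i
      have hy' : g y i = z i := congrFun hy i
      have h1 := hround x i
      have h2 := hround y i
      rw [hx'] at h1
      rw [hy'] at h2
      rw [abs_le] at *
      constructor <;> linarith)
    refine le_trans ?_ (mul_le_mul_right hF _)
    rw [← ENNReal.tsum_mul_left]
    refine ENNReal.tsum_le_tsum fun x => ?_
    refine Set.indicator_apply_le' (fun hx => ?_) fun _ => zero_le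
    rw [Set.indicator_of_mem hx, mul_one, ← ENNReal.ofReal_mul (Real.exp_pos _).le,
      ← Real.exp_add]
    refine ENNReal.ofReal_le_ofReal (Real.exp_le_exp.2 ?_)
    have hsz : s ^ 2 * sqNorm z ≤ 2 * sqNorm (x : ι → ℤ) + m * (s ^ 2 / 2) := by
      have h0 : ∑ i : ι, s ^ 2 / 2 = m * (s ^ 2 / 2) := by simp [hm]
      rw [← h0, sqNorm, sqNorm, Finset.mul_sum, Finset.mul_sum, ← Finset.sum_add_distrib]
      refine Finset.sum_le_sum fun i _ => ?_
      have h1 := hround x i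
      have h2 : g x i = z i := congrFun x.2 i
      rw [h2] at h1
      have h3 := sq_le_sq' (neg_le_of_abs_le h1) (le_of_abs_le h1)
      nlinarith [sq_nonneg (2 * ((x : ι → ℤ) i : ℝ) - s * z i)]
    have h1 := mul_le_mul_of_nonneg_left hsz
      (div_pos hpi (mul_pos (by norm_num : (0 : ℝ) < 4) hs2)).le
    have h2 : Real.pi / (4 * s ^ 2) * (s ^ 2 * sqNorm z) = Real.pi / 4 * sqNorm z := by
      field_simp
    have h3 : Real.pi / (4 * s ^ 2) * (2 * sqNorm (x : ι → ℤ) + m * (s ^ 2 / 2)) =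
      Real.pi / (2 * s ^ 2) * sqNorm (x : ι → ℤ) + Real.pi / 8 * m := by field_simp; ring
    linarith
  have hall : ∑' x, S.indicator
      (fun x => ENNReal.ofReal (Real.exp (-(Real.pi / (2 * s ^ 2)) * sqNorm x))) x ≤
      ENNReal.ofReal (Real.exp (Real.pi / 8 * m)) * ENNReal.ofReal (Real.exp (b * m)) *
        (ENNReal.ofReal (Real.exp (2 * Real.pi * m + 2 * Real.pi * sqNorm c₀ / s ^ 2)) * W) := by
    rw [← ENNReal.tsum_fiberwise _ g]
    refine (ENNReal.tsum_le_tsum hcell).trans ?_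
    rw [ENNReal.tsum_mul_right, ENNReal.tsum_mul_left]
    gcongr
    exact tsum_prod_gaussian_le hsum
  refine (mul_le_mul_right hall _).trans (le_of_eq ?_)
  simp only [← mul_assoc]
  rw [← ENNReal.ofReal_mul (Real.exp_pos _).le, ← Real.exp_add,
    ← ENNReal.ofReal_mul (Real.exp_pos _).le, ← Real.exp_add,
    ← ENNReal.ofReal_mul (Real.exp_pos _).le, ← Real.exp_add]
  congr 3
  ring

/-! ### The largest singular value of a Gaussian matrix -/

lemma norm_toLp_intCast_sq {ι : Type} [Fintype ι] (y : ι → ℤ) :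
    ‖WithLp.toLp 2 (fun i => (y i : ℝ))‖ ^ 2 = sqNorm y := by
  rw [EuclideanSpace.norm_sq_eq]
  simp [sqNorm]

/-- The integer vectors of squared norm at most `7 D`, scaled by `1 / (2 √D)`, form a
`1/4`-net of the unit sphere in every dimension up to `D`. -/
lemma exists_int_near {ι : Type} [Fintype ι] {D : ℝ} (hD : 0 < D) (hι : (Fintype.card ι : ℝ) ≤ D)
    (u : EuclideanSpace ℝ ι) (hu : ‖u‖ = 1) :
    ∃ y : ι → ℤ, sqNorm y ≤ 7 * D ∧
      ‖u - (2 * Real.sqrt D)⁻¹ • WithLp.toLp 2 (fun i => (y i : ℝ))‖ ≤ 1 / 4 := by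
  have hsD : 0 < Real.sqrt D := Real.sqrt_pos.2 hD
  set t := 2 * Real.sqrt D with ht
  have ht0 : 0 < t := by positivity
  have ht2 : t ^ 2 = 4 * D := by rw [ht, mul_pow, Real.sq_sqrt hD.le]; norm_num
  let y : ι → ℤ := fun i => round (t * u i)
  have hclose : ‖u - t⁻¹ • WithLp.toLp 2 (fun i => (y i : ℝ))‖ ≤ 1 / 4 := by
    refine (sq_le_sq₀ (norm_nonneg _) (by norm_num)).1 ?_
    rw [EuclideanSpace.norm_sq_eq]
    have h1 (i : ι) : ‖(u - t⁻¹ • WithLp.toLp 2 (fun i => (y i : ℝ))) i‖ ^ 2 ≤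
        1 / (16 * D) := by
      have h2 : (u - t⁻¹ • WithLp.toLp 2 (fun i => (y i : ℝ))) i =
          t⁻¹ * (t * u i - round (t * u i)) := by
        simp only [PiLp.sub_apply, PiLp.smul_apply, smul_eq_mul, y]
        field_simp
      rw [h2, Real.norm_eq_abs, sq_abs, mul_pow, inv_pow, ht2]
      have h3 := abs_sub_round (t * u i)
      have h4 := sq_le_sq' (neg_le_of_abs_le h3) (le_of_abs_le h3)
      calc (4 * D)⁻¹ * (t * u i - round (t * u i)) ^ 2 ≤ (4 * D)⁻¹ * (1 / 2) ^ 2 := by gcongr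
        _ = 1 / (16 * D) := by field_simp; norm_num
    calc _ ≤ ∑ i : ι, 1 / (16 * D) := Finset.sum_le_sum fun i _ => h1 i
      _ = Fintype.card ι * (1 / (16 * D)) := by simp
      _ ≤ D * (1 / (16 * D)) := by gcongr
      _ = (1 / 4) ^ 2 := by field_simp; norm_num
  refine ⟨y, ?_, hclose⟩
  have h5 : ‖t⁻¹ • WithLp.toLp 2 (fun i => (y i : ℝ))‖ ≤ 5 / 4 := by
    have := norm_sub_norm_le (t⁻¹ • WithLp.toLp 2 (fun i => (y i : ℝ))) u
    rw [norm_sub_rev, hu] at this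
    linarith
  rw [norm_smul, norm_inv, Real.norm_of_nonneg ht0.le, inv_mul_le_iff₀ ht0] at h5
  rw [← norm_toLp_intCast_sq]
  calc _ ≤ (t * (5 / 4)) ^ 2 := by gcongr
    _ ≤ 7 * D := by rw [mul_pow, ht2]; linarith

/-- The operator norm is controlled by the bilinear form on the two nets of integer vectors. -/
lemma s₁_le_of_forall_int {ι κ : Type} [Fintype ι] [Fintype κ] [DecidableEq κ]
    (R : Matrix ι κ ℤ) {D b : ℝ} (hD : 0 < D) (hι : (Fintype.card ι : ℝ) ≤ D)
    (hκ : (Fintype.card κ : ℝ) ≤ D) (hb : 0 ≤ b)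
    (h : ∀ (y : ι → ℤ) (z : κ → ℤ), sqNorm y ≤ 7 * D → sqNorm z ≤ 7 * D →
      ∑ p : ι × κ, (y p.1 : ℝ) * z p.2 * R p.1 p.2 ≤ b * D) :
    s₁ R ≤ b := by
  set L := LinearMap.toContinuousLinearMap
    (Matrix.toEuclideanLin (R.map fun z : ℤ => (z : ℝ))) with hL
  change ‖L‖ ≤ b
  have hsD : 0 < Real.sqrt D := Real.sqrt_pos.2 hD
  have hunit : ∀ v : EuclideanSpace ℝ κ, ‖v‖ = 1 → ‖L v‖ ≤ 9 / 16 * ‖L‖ + b / 4 := by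
    intro v hv
    by_cases hLv : L v = 0
    · rw [hLv, norm_zero]; positivity
    have hn : 0 < ‖L v‖ := norm_pos_iff.2 hLv
    set u : EuclideanSpace ℝ ι := ‖L v‖⁻¹ • L v with hu
    have hu1 : ‖u‖ = 1 := by
      rw [hu, norm_smul, norm_inv, norm_norm, inv_mul_cancel₀ hn.ne']
    have huL : inner ℝ u (L v) = ‖L v‖ := by
      rw [hu, real_inner_smul_left, real_inner_self_eq_norm_sq]
      field_simp
    obtain ⟨y, hy, hyu⟩ := exists_int_near hD hι u hu1
    obtain ⟨z, hz, hzv⟩ := exists_int_near hD hκ v hv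
    set t := (2 * Real.sqrt D)⁻¹ with ht
    have ht2 : t * t = (4 * D)⁻¹ := by
      rw [ht, ← mul_inv]
      congr 1
      nlinarith [Real.mul_self_sqrt hD.le]
    set y' := WithLp.toLp 2 (fun i => (y i : ℝ)) with hy'
    set z' := WithLp.toLp 2 (fun i => (z i : ℝ)) with hz'
    have hsplit : inner ℝ u (L v) = inner ℝ (u - t • y') (L v) +
        inner ℝ (t • y') (L (v - t • z')) + t * t * inner ℝ y' (L z') := by
      rw [map_sub, inner_sub_left, inner_sub_right, map_smul, real_inner_smul_left y' (t • L z'),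
        real_inner_smul_right]
      ring
    have hty : ‖t • y'‖ ≤ 5 / 4 := by
      have := norm_sub_norm_le (t • y') u
      rw [norm_sub_rev, hu1] at this
      linarith
    have h1 : inner ℝ (u - t • y') (L v) ≤ 1 / 4 * ‖L‖ := by
      refine (real_inner_le_norm _ _).trans ?_
      have := L.le_opNorm v
      rw [hv, mul_one] at this
      gcongr
    have h2 : inner ℝ (t • y') (L (v - t • z')) ≤ 5 / 4 * (‖L‖ * (1 / 4)) := by
      refine (real_inner_le_norm _ _).trans ?_
      gcongr
      exact (L.le_opNorm _).trans (by gcongr)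
    have h3 : inner ℝ y' (L z') = ∑ p : ι × κ, (y p.1 : ℝ) * z p.2 * R p.1 p.2 := by
      rw [Fintype.sum_prod_type, PiLp.inner_apply]
      refine Finset.sum_congr rfl fun i _ => ?_
      simp only [hL, hy', hz', LinearMap.coe_toContinuousLinearMap', Matrix.toLpLin_apply,
        Matrix.mulVec, dotProduct, Matrix.map_apply, RCLike.inner_apply, conj_trivial,
        Finset.sum_mul]
      exact Finset.sum_congr rfl fun j _ => by ring
    have h4 : t * t * inner ℝ y' (L z') ≤ b / 4 := by
      rw [h3, ht2, inv_mul_le_iff₀ (by positivity)]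
      calc _ ≤ b * D := h y z hy hz
        _ = 4 * D * (b / 4) := by ring
    rw [← huL, hsplit]
    linarith
  have := ContinuousLinearMap.opNorm_le_of_unit_norm (by positivity) hunit
  linarith

/-- A Gaussian matrix of width `r` with both dimensions at most `D` has largest singular value
`O(r √D)` except with exponentially small probability. -/
lemma exists_gaussianMatrix_s₁_tail :
    ∃ K : ℝ, 0 < K ∧ ∀ (ι κ : Type) [Fintype ι] [Fintype κ] [DecidableEq κ] (D r : ℝ), 0 < D →
      0 < r → (Fintype.card ι : ℝ) ≤ D → (Fintype.card κ : ℝ) ≤ D →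
      (gaussianMatrix ι κ r).toOuterMeasure {R | K * r * Real.sqrt D < s₁ R} ≤
        ENNReal.ofReal (Real.exp (-D)) := by
  have hpi := Real.pi_pos
  obtain ⟨a, ha, hsum⟩ := exists_tsum_gaussian_le_exp Real.pi_pos
  set β := Real.sqrt (49 * (14 * Real.pi + 2 * a + 1) / Real.pi) with hβ
  have hβ2 : Real.pi * β ^ 2 / 49 = 14 * Real.pi + 2 * a + 1 := by
    rw [hβ, Real.sq_sqrt (by positivity)]; field_simp
  have hβ0 : 0 < β := Real.sqrt_pos.2 (by positivity)
  refine ⟨β, hβ0, ?_⟩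
  intro ι κ _ _ _ D r hD hr hι hκ
  have hsD : 0 < Real.sqrt D := Real.sqrt_pos.2 hD
  set B := β * r * Real.sqrt D * D with hB
  rw [gaussianMatrix, PMF.toOuterMeasure_map_apply]
  let E : (ι → ℤ) × (κ → ℤ) → Set (ι × κ → ℤ) := fun p =>
    {x | sqNorm p.1 ≤ 7 * D ∧ sqNorm p.2 ≤ 7 * D ∧
      B ≤ ∑ ij : ι × κ, (p.1 ij.1 : ℝ) * p.2 ij.2 * x ij}
  have hcover : (fun x : ι × κ → ℤ => Matrix.of fun i j => x (i, j)) ⁻¹'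
      {R | β * r * Real.sqrt D < s₁ R} ⊆ ⋃ p, E p := by
    intro x hx
    have hx' : β * r * Real.sqrt D < s₁ (Matrix.of fun i j => x (i, j)) := hx
    by_contra hcon
    refine not_le.2 hx' (s₁_le_of_forall_int _ hD hι hκ (by positivity) fun y z hy hz => ?_)
    by_contra hlt
    exact hcon (Set.mem_iUnion.2 ⟨(y, z), hy, hz, (not_le.1 hlt).le⟩)
  -- the factors depending on `p` replace a count of the net by convergent Gaussian sums
  have hE (p : (ι → ℤ) × (κ → ℤ)) : (gaussianVec (ι × κ) r).toOuterMeasure (E p) ≤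
      ENNReal.ofReal (Real.exp (-(2 * a + 1) * D)) *
        (ENNReal.ofReal (Real.exp (-Real.pi * sqNorm p.1)) *
          ENNReal.ofReal (Real.exp (-Real.pi * sqNorm p.2))) := by
    by_cases hp : sqNorm p.1 ≤ 7 * D ∧ sqNorm p.2 ≤ 7 * D
    · have hV : ∑ ij : ι × κ, ((p.1 ij.1 : ℝ) * p.2 ij.2) ^ 2 ≤ 49 * D ^ 2 := by
        have : ∑ ij : ι × κ, ((p.1 ij.1 : ℝ) * p.2 ij.2) ^ 2 = sqNorm p.1 * sqNorm p.2 := by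
          rw [sqNorm, sqNorm, Finset.sum_mul_sum, Fintype.sum_prod_type]
          simp only [mul_pow]
        rw [this]
        calc _ ≤ (7 * D) * (7 * D) :=
              mul_le_mul hp.1 hp.2 (sqNorm_nonneg _) (by positivity)
          _ = 49 * D ^ 2 := by ring
      have h1 := gaussianVec_le_dotProduct (B := B) hr
        (fun ij : ι × κ => (p.1 ij.1 : ℝ) * p.2 ij.2) (by positivity) (by positivity) hV
      refine (MeasureTheory.measure_mono fun x hx => hx.2.2).trans (h1.trans ?_)
      rw [← ENNReal.ofReal_mul (Real.exp_pos _).le, ← ENNReal.ofReal_mul (Real.exp_pos _).le,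
        ← Real.exp_add, ← Real.exp_add]
      refine ENNReal.ofReal_le_ofReal (Real.exp_le_exp.2 ?_)
      have h2 : Real.pi * B ^ 2 / (r ^ 2 * (49 * D ^ 2)) = (Real.pi * β ^ 2 / 49) * D := by
        rw [hB, mul_pow, mul_pow, mul_pow, Real.sq_sqrt hD.le]
        field_simp
      rw [h2, hβ2]
      have h3 := mul_le_mul_of_nonneg_left hp.1 hpi.le
      have h4 := mul_le_mul_of_nonneg_left hp.2 hpi.le
      linarith
    · have : E p = ∅ := Set.eq_empty_iff_forall_notMem.2 fun x hx => hp ⟨hx.1, hx.2.1⟩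
      rw [this, MeasureTheory.measure_empty]
      exact zero_le
  refine (MeasureTheory.measure_mono hcover).trans ((MeasureTheory.measure_iUnion_le _).trans
    ((ENNReal.tsum_le_tsum hE).trans ?_))
  rw [ENNReal.tsum_mul_left, ENNReal.tsum_prod (f := fun (y : ι → ℤ) (z : κ → ℤ) =>
    ENNReal.ofReal (Real.exp (-Real.pi * sqNorm y)) *
      ENNReal.ofReal (Real.exp (-Real.pi * sqNorm z)))]
  simp_rw [ENNReal.tsum_mul_left, ENNReal.tsum_mul_right]
  refine (mul_le_mul_right (mul_le_mul' (tsum_prod_gaussian_le hsum)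
    (tsum_prod_gaussian_le hsum)) _).trans ?_
  rw [← ENNReal.ofReal_mul (Real.exp_pos _).le, ← ENNReal.ofReal_mul (Real.exp_pos _).le,
    ← Real.exp_add, ← Real.exp_add]
  refine ENNReal.ofReal_le_ofReal (Real.exp_le_exp.2 ?_)
  have h1 := mul_le_mul_of_nonneg_left hι ha.le
  have h2 := mul_le_mul_of_nonneg_left hκ ha.le
  linarith

/-! ### Bit decomposition and short preimages -/

lemma sum_range_testBit (a k : ℕ) :
    ∑ j ∈ Finset.range k, 2 ^ j * (a.testBit j).toNat = a % 2 ^ k := by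
  induction k with
  | zero => simp [Nat.mod_one]
  | succ k ih => rw [Finset.sum_range_succ, ih, Nat.pow_succ, Nat.mod_mul, Nat.toNat_testBit]

lemma sum_two_pow_mul_testBit {q : ℕ} [NeZero q] (a : ZMod q) :
    ∑ j : Fin (bitLen q), (2 : ZMod q) ^ (j : ℕ) * (if a.val.testBit j then 1 else 0) = a := by
  have h := sum_range_testBit a.val (bitLen q)
  rw [Nat.mod_eq_of_lt ((ZMod.val_lt a).trans_le (Nat.le_pow_clog one_lt_two q)),
    ← Fin.sum_univ_eq_sum_range fun j => 2 ^ j * (a.val.testBit j).toNat] at h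
  have h2 := congrArg (Nat.cast (R := ZMod q)) h
  rw [ZMod.natCast_val, ZMod.cast_id] at h2
  conv_rhs => rw [← h2]
  push_cast
  refine Finset.sum_congr rfl fun j _ => ?_
  cases a.val.testBit j <;> simp

lemma BD_dotProduct_P2 {ι : Type} [Fintype ι] {q : ℕ} [NeZero q] (c x : ι → ZMod q) :
    BD c ⬝ᵥ P2 x = x ⬝ᵥ c := by
  rw [dotProduct, dotProduct, Fintype.sum_prod_type]
  refine Finset.sum_congr rfl fun i _ => ?_
  conv_rhs => rw [← sum_two_pow_mul_testBit (c i), Finset.mul_sum]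
  refine Finset.sum_congr rfl fun j _ => ?_
  simp only [BD, P2]
  ring

/-- The bit decomposition as a `0`/`1` vector of integers. -/
def bits {ι : Type} {q : ℕ} (x : ι → ZMod q) : ι × Fin (bitLen q) → ℤ :=
  fun ij => if (x ij.1).val.testBit ij.2 then 1 else 0

lemma modVec_bits {ι : Type} {q : ℕ} (x : ι → ZMod q) : modVec q (bits x) = BD x := by
  funext ij
  simp only [modVec, bits, BD]
  split <;> simp

lemma sqNorm_bits_le {ι : Type} [Fintype ι] {q : ℕ} (x : ι → ZMod q) :
    sqNorm (bits x) ≤ Fintype.card ι * bitLen q := by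
  have : ∀ ij ∈ (Finset.univ : Finset (ι × Fin (bitLen q))), (bits x ij : ℝ) ^ 2 ≤ 1 := by
    intro ij _
    simp only [bits]
    split <;> simp
  refine (Finset.sum_le_sum this).trans ?_
  simp

lemma gadget_mulVec_BD {n q : ℕ} [NeZero q] (v : Fin n → ZMod q) :
    gadget n q *ᵥ BD v = v := by
  funext i
  rw [Matrix.mulVec, dotProduct, Fintype.sum_prod_type, Finset.sum_eq_single i]
  · conv_rhs => rw [← sum_two_pow_mul_testBit (v i)]
    refine Finset.sum_congr rfl fun j _ => ?_
    simp [gadget, BD]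
  · intro i' _ hi'
    refine Finset.sum_eq_zero fun j _ => ?_
    simp [gadget, hi'.symm]
  · simp

lemma modMat_mulVec {ι κ : Type} [Fintype κ] (q : ℕ) (R : Matrix ι κ ℤ) (w : κ → ℤ) :
    modMat q R *ᵥ modVec q w = modVec q (R *ᵥ w) := by
  funext i
  simp [Matrix.mulVec, dotProduct, modVec]

lemma sqNorm_mulVec_le {ι κ : Type} [Fintype ι] [Fintype κ] [DecidableEq κ] (R : Matrix ι κ ℤ)
    (w : κ → ℤ) : sqNorm (R *ᵥ w) ≤ s₁ R ^ 2 * sqNorm w := by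
  have h := (LinearMap.toContinuousLinearMap (Matrix.toEuclideanLin
    (R.map fun z : ℤ => (z : ℝ)))).le_opNorm (WithLp.toLp 2 fun i => (w i : ℝ))
  have h2 : LinearMap.toContinuousLinearMap (Matrix.toEuclideanLin (R.map fun z : ℤ => (z : ℝ)))
      (WithLp.toLp 2 fun i => (w i : ℝ)) = WithLp.toLp 2 fun i => ((R *ᵥ w) i : ℝ) := by
    ext i
    simp [Matrix.toLpLin_apply, Matrix.mulVec, dotProduct]
  rw [h2] at h
  rw [← norm_toLp_intCast_sq, ← norm_toLp_intCast_sq, ← mul_pow]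
  exact pow_le_pow_left₀ (norm_nonneg _) h 2

lemma idMatrix_mulVec {n q mbar : ℕ} (Abar : Matrix (Fin n) (Fin mbar) (ZMod q))
    (R : Matrix (Fin mbar) (GIdx n q) ℤ) (Hid : Matrix (Fin n) (Fin n) (ZMod q))
    (w : GIdx n q → ℤ) :
    idMatrix (publicMatrix Abar R) Hid *ᵥ modVec q (Sum.elim (R *ᵥ w) w) =
      Hid *ᵥ (gadget n q *ᵥ modVec q w) := by
  have h : modVec q (Sum.elim (R *ᵥ w) w) = Sum.elim (modMat q R *ᵥ modVec q w) (modVec q w) := by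
    rw [modMat_mulVec]
    funext i
    cases i <;> rfl
  rw [h, idMatrix, publicMatrix, Matrix.add_mulVec, Matrix.fromCols_mulVec_sumElim,
    Matrix.fromCols_mulVec_sumElim]
  simp [Matrix.mulVec_mulVec, Matrix.neg_mulVec]

/-- The trapdoor yields a short vector in the coset of every syndrome: `(R w, w)` with `w` the bits
of `H⁻¹ u`. -/
lemma exists_short_mem_latticeCoset {n q mbar : ℕ} [NeZero q]
    (Abar : Matrix (Fin n) (Fin mbar) (ZMod q)) (R : Matrix (Fin mbar) (GIdx n q) ℤ)
    (Hid : Matrix (Fin n) (Fin n) (ZMod q)) (hH : IsUnit Hid) (u : Fin n → ZMod q) :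
    ∃ c₀ ∈ latticeCoset (idMatrix (publicMatrix Abar R) Hid) u,
      sqNorm c₀ ≤ (s₁ R ^ 2 + 1) * (n * bitLen q) := by
  set w : GIdx n q → ℤ := bits (Hid⁻¹ *ᵥ u) with hw
  refine ⟨Sum.elim (R *ᵥ w) w, ?_, ?_⟩
  · change idMatrix (publicMatrix Abar R) Hid *ᵥ modVec q (Sum.elim (R *ᵥ w) w) = u
    rw [idMatrix_mulVec, hw, modVec_bits, gadget_mulVec_BD, Matrix.mulVec_mulVec,
      Matrix.mul_nonsing_inv _ ((Matrix.isUnit_iff_isUnit_det _).1 hH), Matrix.one_mulVec]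
  · have h1 : sqNorm (Sum.elim (R *ᵥ w) w) = sqNorm (R *ᵥ w) + sqNorm w := by
      simp [sqNorm, Fintype.sum_sum_type]
    have h2 : sqNorm w ≤ n * bitLen q := by
      simpa using sqNorm_bits_le (Hid⁻¹ *ᵥ u)
    rw [h1]
    calc _ ≤ s₁ R ^ 2 * sqNorm w + sqNorm w := by gcongr; exact sqNorm_mulVec_le R w
      _ = (s₁ R ^ 2 + 1) * sqNorm w := by ring
      _ ≤ _ := by gcongr

lemma latticeCoset_add_sub_mem {n q : ℕ} {ι : Type} [Fintype ι]
    {A : Matrix (Fin n) ι (ZMod q)} {u : Fin n → ZMod q} {c₀ x y : ι → ℤ}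
    (hc : c₀ ∈ latticeCoset A u) (hx : x ∈ latticeCoset A u) (hy : y ∈ latticeCoset A u) :
    c₀ + x - y ∈ latticeCoset A u := by
  change A *ᵥ modVec q c₀ = u at hc
  change A *ᵥ modVec q x = u at hx
  change A *ᵥ modVec q y = u at hy
  change A *ᵥ modVec q (c₀ + x - y) = u
  have h : modVec q (c₀ + x - y) = modVec q c₀ + modVec q x - modVec q y := by
    funext i; simp [modVec]
  rw [h, Matrix.mulVec_sub, Matrix.mulVec_add, hc, hx, hy, add_sub_cancel_right]

/-! ### Decryption noise -/

/-- The ciphertext `ct` decrypts under `x` to an encoding of `b` with an integer error of absolute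
value at most `M`. -/
def HasNoise {n q mbar : ℕ} (x : Idx n q mbar → ℤ) (b : Bool) (M : ℝ)
    (ct : (Idx n q mbar → ZMod q) × ZMod q) : Prop :=
  ∃ E : ℤ, |(E : ℝ)| ≤ M ∧
    ct.2 - modVec q x ⬝ᵥ ct.1 = (E : ZMod q) + if b then ((q / 2 : ℕ) : ZMod q) else 0

lemma valMinAbs_intCast_of_le {q : ℕ} [NeZero q] {E : ℤ} (hE : 2 * |E| < q) :
    ((E : ZMod q)).valMinAbs = E := by
  rw [ZMod.valMinAbs_spec]
  have := abs_le.1 (le_refl |E|)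
  exact ⟨rfl, by constructor <;> linarith⟩

lemma decrypt_eq_of_hasNoise {n q mbar : ℕ} [NeZero q] (hq : 2 ≤ q) {x : Idx n q mbar → ℤ}
    {b : Bool} {ct : (Idx n q mbar → ZMod q) × ZMod q} (h : HasNoise x b (q / 16) ct) :
    decrypt x ct = b := by
  obtain ⟨E, hE, hct⟩ := h
  have hE' : 16 * |E| ≤ q := by
    have : 16 * |(E : ℝ)| ≤ q := by linarith
    exact_mod_cast this
  have habs := abs_le.1 (le_refl |E|)
  have hh : 2 * (q / 2) ≤ q ∧ q ≤ 2 * (q / 2) + 1 := by omega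
  set h := q / 2 with hhdef
  have key (z : ℤ) (hz : z = E - h ∨ z = E + h) : |E| < |((z : ℤ) : ZMod q).valMinAbs| := by
    obtain ⟨h1, h2⟩ := (ZMod.valMinAbs_spec ((z : ℤ) : ZMod q) _).1 rfl
    rw [ZMod.intCast_eq_intCast_iff, Int.modEq_iff_dvd] at h1
    obtain ⟨t, ht⟩ := h1
    by_contra hcon
    have hcon' := abs_le.1 (not_lt.1 hcon)
    have hqpos : (2 : ℤ) ≤ q := by exact_mod_cast hq
    have hh' : 2 * (h : ℤ) ≤ q ∧ (q : ℤ) ≤ 2 * h + 1 := by exact_mod_cast hh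
    -- `z = E ± h` and a residue of size at most `|E|` would differ by a multiple `t q` of `q`,
    -- which is impossible as `h` is about `q / 2`
    have ht0 : t = 0 ∨ 1 ≤ t ∨ t ≤ -1 := by omega
    rcases ht0 with rfl | ht1 | ht1
    · rcases hz with rfl | rfl <;> omega
    · have := mul_le_mul_of_nonneg_left ht1 (by omega : (0 : ℤ) ≤ q)
      rcases hz with rfl | rfl <;> omega
    · have := mul_le_mul_of_nonneg_left ht1 (by omega : (0 : ℤ) ≤ q)
      rcases hz with rfl | rfl <;> omega
  have hEv : ((E : ZMod q)).valMinAbs = E := valMinAbs_intCast_of_le (by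
    have : (2 : ℤ) ≤ q := by exact_mod_cast hq
    linarith [abs_nonneg E])
  unfold decrypt
  simp only [hct]
  cases b with
  | false =>
    have := key (E - h) (Or.inl rfl)
    push_cast at this
    simp only [Bool.false_eq_true, if_false, add_zero]
    rw [hEv, if_pos this]
  | true =>
    have := key (E + h) (Or.inr rfl)
    push_cast at this
    simp only [if_true]
    rw [add_sub_cancel_right, hEv, if_neg this.not_gt]

lemma modVec_dotProduct {ι : Type} [Fintype ι] (q : ℕ) (x y : ι → ℤ) :
    modVec q x ⬝ᵥ modVec q y = ((∑ i, x i * y i : ℤ) : ZMod q) := by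
  simp [dotProduct, modVec]

lemma hasNoise_encryption {n q mbar : ℕ} {A : Matrix (Fin n) (Idx n q mbar) (ZMod q)}
    {u : Fin n → ZMod q} {x : Idx n q mbar → ℤ} (hx : x ∈ latticeCoset A u) (b : Bool)
    (s : Fin n → ZMod q) {e : ℤ} {e₀ : Fin mbar → ℤ} {e₁ : GIdx n q → ℤ} {M : ℝ}
    (he : |(e : ℝ)| ≤ M) (he₀ : |∑ i, (x (Sum.inl i) : ℝ) * e₀ i| ≤ M)
    (he₁ : |∑ i, (x (Sum.inr i) : ℝ) * e₁ i| ≤ M) :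
    HasNoise x b (3 * M) (Aᵀ *ᵥ s + modVec q (Sum.elim e₀ e₁),
      u ⬝ᵥ s + (e : ZMod q) + if b then ((q / 2 : ℕ) : ZMod q) else 0) := by
  refine ⟨e - ∑ i, x i * Sum.elim e₀ e₁ i, ?_, ?_⟩
  · rw [Fintype.sum_sum_type]
    push_cast
    simp only [Sum.elim_inl, Sum.elim_inr]
    rw [abs_le] at *
    constructor <;> linarith [he.1, he.2, he₀.1, he₀.2, he₁.1, he₁.2]
  · change A *ᵥ modVec q x = u at hx
    have h1 : modVec q x ⬝ᵥ Aᵀ *ᵥ s = u ⬝ᵥ s := by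
      rw [Matrix.dotProduct_mulVec, Matrix.vecMul_transpose, hx]
    dsimp only
    rw [dotProduct_add, h1, modVec_dotProduct, Int.cast_sub]
    ring

lemma hasNoise_reEncrypt {n q mbar : ℕ} [NeZero q] {Aj : Matrix (Fin n) (Idx n q mbar) (ZMod q)}
    {u : Fin n → ZMod q} {xi xj : Idx n q mbar → ℤ} (hxj : xj ∈ latticeCoset Aj u) {b : Bool}
    {ct : (Idx n q mbar → ZMod q) × ZMod q} {M M' : ℝ} (hct : HasNoise xi b M ct)
    (r₁ : Matrix (BitIdx n q mbar) (Fin n) ℤ) {r₂ : BitIdx n q mbar → ℤ}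
    (hr₂ : |∑ i, (bits ct.1 i : ℝ) * r₂ i| ≤ M') :
    HasNoise xj b (M + M') (reEncrypt (Matrix.fromBlocks (modMat q r₁ * Aj)
      (Matrix.replicateCol Unit (modMat q r₁ *ᵥ u + modVec q r₂ - P2 (modVec q xi))) 0 1) ct) := by
  obtain ⟨E, hE, hEq⟩ := hct
  refine ⟨E + ∑ i, bits ct.1 i * r₂ i, ?_, ?_⟩
  · push_cast
    exact (abs_add_le _ _).trans (add_le_add hE hr₂)
  · change Aj *ᵥ modVec q xj = u at hxj
    have h1 : (reEncrypt (Matrix.fromBlocks (modMat q r₁ * Aj)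
      (Matrix.replicateCol Unit (modMat q r₁ *ᵥ u + modVec q r₂ - P2 (modVec q xi))) 0 1) ct).1 =
        BD ct.1 ᵥ* (modMat q r₁ * Aj) := by
      funext i
      simp [reEncrypt, Matrix.vecMul_fromBlocks]
    have h2 : (reEncrypt (Matrix.fromBlocks (modMat q r₁ * Aj)
      (Matrix.replicateCol Unit (modMat q r₁ *ᵥ u + modVec q r₂ - P2 (modVec q xi))) 0 1) ct).2 =
        BD ct.1 ⬝ᵥ (modMat q r₁ *ᵥ u + modVec q r₂ - P2 (modVec q xi)) + ct.2 := by
      simp [reEncrypt, Matrix.vecMul, dotProduct]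
    have h3 : modVec q xj ⬝ᵥ (BD ct.1 ᵥ* (modMat q r₁ * Aj)) =
        BD ct.1 ⬝ᵥ (modMat q r₁ *ᵥ u) := by
      rw [dotProduct_comm, ← Matrix.dotProduct_mulVec, ← Matrix.mulVec_mulVec, hxj]
    rw [h1, h2, h3, dotProduct_sub, dotProduct_add, BD_dotProduct_P2, Int.cast_add,
      ← modVec_dotProduct, modVec_bits]
    linear_combination hEq

/-! ### Failure probability of the algorithms -/

lemma HasNoise.mono {n q mbar : ℕ} {x : Idx n q mbar → ℤ} {b : Bool} {M M' : ℝ} (h : M ≤ M')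
    {ct : (Idx n q mbar → ZMod q) × ZMod q} (hct : HasNoise x b M ct) : HasNoise x b M' ct := by
  obtain ⟨E, hE, hEq⟩ := hct
  exact ⟨E, hE.trans h, hEq⟩

lemma sum_sq_inl_le_sqNorm {ι κ : Type} [Fintype ι] [Fintype κ] (x : ι ⊕ κ → ℤ) :
    ∑ i, (x (Sum.inl i) : ℝ) ^ 2 ≤ sqNorm x := by
  rw [sqNorm, Fintype.sum_sum_type]
  exact le_add_of_nonneg_right (Finset.sum_nonneg fun _ _ => sq_nonneg _)

lemma sum_sq_inr_le_sqNorm {ι κ : Type} [Fintype ι] [Fintype κ] (x : ι ⊕ κ → ℤ) :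
    ∑ i, (x (Sum.inr i) : ℝ) ^ 2 ≤ sqNorm x := by
  rw [sqNorm, Fintype.sum_sum_type]
  exact le_add_of_nonneg_left (Finset.sum_nonneg fun _ _ => sq_nonneg _)

/-- Every part of the encryption noise is small: `e` by itself, `⟨x₀, e₀⟩` and `⟨x₁, e₁⟩` by
sub-Gaussian concentration for a fixed key `x`, where the width of `e₁` is controlled through the
norm of `e₀`. -/
lemma encrypt_noise_tail {K : ℝ} (hK : IsNormTailConstant K)
    {n q mbar : ℕ} [NeZero q] (hmbar : 1 ≤ mbar) {r α : ℝ} (hr : 0 < r) (hα : 0 < α)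
    {A : Matrix (Fin n) (Idx n q mbar) (ZMod q)} {u : Fin n → ZMod q} {x : Idx n q mbar → ℤ}
    (hx : x ∈ latticeCoset A u) (b : Bool) {X Y M θ : ℝ} (hX : 0 < X) (hxX : sqNorm x ≤ X)
    (hM : 0 ≤ M) (h₁ : θ ≤ Real.pi * M ^ 2 / (α * q) ^ 2)
    (h₂ : θ ≤ Real.pi * M ^ 2 / ((α * q) ^ 2 * X))
    (h₃ : θ ≤ Real.pi * M ^ 2 / ((Y + mbar * (α * q) ^ 2) * r ^ 2 * X))
    (h₄ : θ ≤ Real.pi * Y / (2 * (α * q) ^ 2) - K * mbar) :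
    (encrypt r α A u b).toOuterMeasure {ct | ¬ HasNoise x b (3 * M) ct} ≤
      ENNReal.ofReal (7 * Real.exp (-θ)) := by
  have hq : (0 : ℝ) < q := by exact_mod_cast NeZero.pos q
  have hw : 0 < α * q := by positivity
  have hm : (1 : ℝ) ≤ mbar := by exact_mod_cast hmbar
  have hexp := Real.exp_pos (-θ)
  have hpi := Real.pi_pos
  have hsplit : ENNReal.ofReal (7 * Real.exp (-θ)) = ENNReal.ofReal (2 * Real.exp (-θ)) +
      ((ENNReal.ofReal (Real.exp (-θ)) + ENNReal.ofReal (2 * Real.exp (-θ))) +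
        ENNReal.ofReal (2 * Real.exp (-θ))) := by
    rw [← ENNReal.ofReal_add, ← ENNReal.ofReal_add, ← ENNReal.ofReal_add]
    · congr 1; ring
    all_goals positivity
  have hmono {t : ℝ} (ht : θ ≤ t) :
      ENNReal.ofReal (2 * Real.exp (-t)) ≤ ENNReal.ofReal (2 * Real.exp (-θ)) :=
    ENNReal.ofReal_le_ofReal (by gcongr)
  rw [hsplit]
  refine toOuterMeasure_bind_le_of_forall _ _ _ fun s => ?_
  refine toOuterMeasure_bind_le _ _ _ {e : ℤ | M ≤ |(e : ℝ)|}
    ((gaussianInt_le_abs hw hM).trans (hmono h₁)) fun e he => ?_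
  refine toOuterMeasure_bind_le _ _ _
    ({e₀ | Y ≤ sqNorm e₀} ∪ {e₀ | M ≤ |∑ i, (x (Sum.inl i) : ℝ) * e₀ i|}) ?_ fun e₀ he₀ => ?_
  · refine (MeasureTheory.measure_union_le _ _).trans (add_le_add ?_ ?_)
    · refine (hK (Fin mbar) Set.univ 0 (Set.mem_univ _) (fun _ _ _ _ => Set.mem_univ _) (α * q) hw
        Y).trans (ENNReal.ofReal_le_ofReal (Real.exp_le_exp.2 ?_))
      have h0 : sqNorm (0 : Fin mbar → ℤ) = 0 := by simp [sqNorm]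
      rw [h0, Fintype.card_fin, mul_zero, zero_div]
      linarith
    · exact (gaussianVec_le_abs_dotProduct hw _ hX hM
        ((sum_sq_inl_le_sqNorm x).trans hxX)).trans (hmono h₂)
  · have he₀' : ¬ (Y ≤ sqNorm e₀ ∨ M ≤ |∑ i, (x (Sum.inl i) : ℝ) * e₀ i|) := he₀
    rw [not_or, not_le, not_le] at he₀'
    have he' : ¬ M ≤ |(e : ℝ)| := he
    rw [not_le] at he'
    have hpos : 0 < (sqNorm e₀ + mbar * (α * q) ^ 2) * r ^ 2 := by
      have := sqNorm_nonneg e₀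
      positivity
    have htail := gaussianVec_le_abs_dotProduct (Real.sqrt_pos.2 hpos)
      (fun i => (x (Sum.inr i) : ℝ)) hX hM ((sum_sq_inr_le_sqNorm x).trans hxX)
    rw [Real.sq_sqrt hpos.le] at htail
    have hθ : θ ≤ Real.pi * M ^ 2 / ((sqNorm e₀ + mbar * (α * q) ^ 2) * r ^ 2 * X) := by
      refine h₃.trans ?_
      gcongr
      exact he₀'.1.le
    have hbad := htail.trans (hmono hθ)
    rw [← add_zero (ENNReal.ofReal (2 * Real.exp (-θ)))]
    refine toOuterMeasure_bind_le _ _ _ _ hbad fun e₁ he₁ => ?_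
    have he₁' : ¬ M ≤ |∑ i, (x (Sum.inr i) : ℝ) * e₁ i| := he₁
    rw [not_le] at he₁'
    refine (toOuterMeasure_pure_eq_zero ?_).le
    exact not_not.2 (hasNoise_encryption hx b s he'.le he₀'.2.le he₁'.le)

/-- A secret key lies in the required coset and is short, except with small probability. -/
lemma sampler_tail {K : ℝ} (hK : IsNormTailConstant K)
    {n q mbar : ℕ} [NeZero q] {Samp : Sampler n q mbar} {σ r δ : ℝ} (hσ : 0 < σ) (hr : 0 < r)
    (hSamp : Samp.IsClose σ r δ) (R : Matrix (Fin mbar) (GIdx n q) ℤ)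
    (Abar : Matrix (Fin n) (Fin mbar) (ZMod q)) {Hid : Matrix (Fin n) (Fin n) (ZMod q)}
    (hH : IsUnit Hid) (u : Fin n → ZMod q) {S X θ : ℝ} (hS : s₁ R ≤ S) (hX : 0 ≤ X)
    (h : θ ≤ Real.pi * X / (2 * (σ ^ 2 * (S ^ 2 + 1) * r ^ 2)) -
      K * (mbar + n * bitLen q) - 2 * Real.pi * (n * bitLen q) / (σ ^ 2 * r ^ 2)) :
    (Samp R Abar Hid u).toOuterMeasure
      {x | ¬ (x ∈ latticeCoset (idMatrix (publicMatrix Abar R) Hid) u ∧ sqNorm x ≤ X)} ≤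
      ENNReal.ofReal (Real.exp (-θ) + 2 * δ) := by
  have hpi := Real.pi_pos
  set Λ := latticeCoset (idMatrix (publicMatrix Abar R) Hid) u with hΛ
  obtain ⟨c₀, hc₀, hc₀n⟩ := exists_short_mem_latticeCoset Abar R Hid hH u
  have hs0 : 0 ≤ s₁ R := norm_nonneg _
  have hkey : 0 < keyParam σ r R := by unfold keyParam; positivity
  have hkey2 : keyParam σ r R ^ 2 = σ ^ 2 * (s₁ R ^ 2 + 1) * r ^ 2 := by
    rw [keyParam, mul_pow, mul_pow, Real.sq_sqrt (by positivity)]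
  have hδ : 0 ≤ δ := (statDist_nonneg _ _).trans (hSamp R Abar Hid u hH)
  have hD : (discreteGaussian Λ (keyParam σ r R)).toOuterMeasure
      {x | ¬ (x ∈ Λ ∧ sqNorm x ≤ X)} ≤ ENNReal.ofReal (Real.exp (-θ)) := by
    have hsub : {x | ¬ (x ∈ Λ ∧ sqNorm x ≤ X)} ⊆ Λᶜ ∪ {x | X ≤ sqNorm x} := by
      intro x hx
      by_cases hxΛ : x ∈ Λ
      · exact Or.inr (le_of_lt (not_le.1 fun hle => hx ⟨hxΛ, hle⟩))
      · exact Or.inl hxΛ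
    refine (MeasureTheory.measure_mono hsub).trans ((MeasureTheory.measure_union_le _ _).trans ?_)
    rw [discreteGaussian_toOuterMeasure_compl ⟨c₀, hc₀⟩ hkey, zero_add]
    refine (hK _ Λ c₀ hc₀ (fun x hx y hy => latticeCoset_add_sub_mem hc₀ hx hy) _ hkey X).trans
      (ENNReal.ofReal_le_ofReal (Real.exp_le_exp.2 ?_))
    have hcard : (Fintype.card (Idx n q mbar) : ℝ) = mbar + n * bitLen q := by simp
    rw [hkey2, hcard]
    have h1 : Real.pi * X / (2 * (σ ^ 2 * (S ^ 2 + 1) * r ^ 2)) ≤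
        Real.pi * X / (2 * (σ ^ 2 * (s₁ R ^ 2 + 1) * r ^ 2)) := by
      gcongr
    have h2 : 2 * Real.pi * sqNorm c₀ / (σ ^ 2 * (s₁ R ^ 2 + 1) * r ^ 2) ≤
        2 * Real.pi * (n * bitLen q) / (σ ^ 2 * r ^ 2) := by
      rw [div_le_div_iff₀ (by positivity) (by positivity)]
      calc _ ≤ 2 * Real.pi * ((s₁ R ^ 2 + 1) * (n * bitLen q)) * (σ ^ 2 * r ^ 2) := by gcongr
        _ = _ := by ring
    linarith
  refine (toOuterMeasure_le_add_statDist _ _ _).trans ((add_le_add hD le_rfl).trans ?_)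
  rw [← ENNReal.ofReal_add (Real.exp_pos _).le (mul_nonneg zero_le_two (statDist_nonneg _ _))]
  have := hSamp R Abar Hid u hH
  exact ENNReal.ofReal_le_ofReal (by linarith)

/-- Re-encryption adds at most `M'` to the noise: the only new error is the product of the bits of
the ciphertext with the Gaussian vector `r₂`. -/
lemma reKey_noise_tail {n q mbar : ℕ} [NeZero q] {r : ℝ} (hr : 0 < r)
    {Aj : Matrix (Fin n) (Idx n q mbar) (ZMod q)} {u : Fin n → ZMod q} {xi xj : Idx n q mbar → ℤ}
    (hxj : xj ∈ latticeCoset Aj u) {b : Bool} {ct : (Idx n q mbar → ZMod q) × ZMod q}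
    {M M' V θ : ℝ} (hct : HasNoise xi b M ct) (hM' : 0 ≤ M') (hV : 0 < V)
    (hVm : ((mbar + n * bitLen q : ℝ)) * bitLen q ≤ V) (h : θ ≤ Real.pi * M' ^ 2 / (r ^ 2 * V)) :
    (reKey r Aj u xi).toOuterMeasure {rk | ¬ HasNoise xj b (M + M') (reEncrypt rk ct)} ≤
      ENNReal.ofReal (2 * Real.exp (-θ)) := by
  refine toOuterMeasure_bind_le_of_forall _ _ _ fun r₁ => ?_
  rw [← add_zero (ENNReal.ofReal (2 * Real.exp (-θ)))]
  refine toOuterMeasure_bind_le _ _ _ {r₂ | M' ≤ |∑ i, (bits ct.1 i : ℝ) * r₂ i|} ?_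
    fun r₂ hr₂ => ?_
  · have hb : ∑ i, (bits ct.1 i : ℝ) ^ 2 ≤ V := by
      refine (sqNorm_bits_le ct.1).trans (le_trans (le_of_eq ?_) hVm)
      simp
    refine (gaussianVec_le_abs_dotProduct hr _ hV hM' hb).trans (ENNReal.ofReal_le_ofReal ?_)
    gcongr
  · have hr₂' : ¬ M' ≤ |∑ i, (bits ct.1 i : ℝ) * r₂ i| := hr₂
    refine (toOuterMeasure_pure_eq_zero ?_).le
    exact not_not.2 (hasNoise_reEncrypt hxj hct r₁ (not_le.1 hr₂').le)

/-! ### Choice of the noise parameters -/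

/-- The squared key norm `τ σ² (K₁² (c + 1) + 1) N² r⁴` leaves a tail exponent of at least `N`. -/
lemma le_key_exponent {c σ K K₁ τ N r m : ℝ} (hc : 0 < c) (hσ : 0 < σ) (hK : 0 < K)
    (hτ : τ = 2 / Real.pi * (K * (c + 1) + 2 * Real.pi / σ ^ 2 + 1)) (hN : 1 ≤ N) (hr : 1 ≤ r)
    (hm : m ≤ c * N) :
    N ≤ Real.pi * (τ * σ ^ 2 * (K₁ ^ 2 * (c + 1) + 1) * N ^ 2 * r ^ 4) /
          (2 * (σ ^ 2 * ((K₁ * r * Real.sqrt ((c + 1) * N)) ^ 2 + 1) * r ^ 2)) -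
        K * (m + N) - 2 * Real.pi * N / (σ ^ 2 * r ^ 2) := by
  have hpi := Real.pi_pos
  have hN0 : 0 < N := by linarith
  have hr0 : 0 < r := by linarith
  have hr2 : 1 ≤ r ^ 2 := one_le_pow₀ hr
  have hτ0 : 0 < τ := by rw [hτ]; positivity
  have hS2 : (K₁ * r * Real.sqrt ((c + 1) * N)) ^ 2 = K₁ ^ 2 * (c + 1) * (r ^ 2 * N) := by
    rw [mul_pow, Real.sq_sqrt (by positivity)]; ring
  have h1 : σ ^ 2 * (K₁ ^ 2 * (c + 1) * (r ^ 2 * N) + 1) * r ^ 2 ≤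
      σ ^ 2 * (K₁ ^ 2 * (c + 1) + 1) * (N * r ^ 4) := by
    have h2 : 1 ≤ r ^ 2 * N := one_le_mul_of_one_le_of_one_le hr2 hN
    have h3 : K₁ ^ 2 * (c + 1) * (r ^ 2 * N) + 1 ≤ (K₁ ^ 2 * (c + 1) + 1) * (r ^ 2 * N) := by
      linarith
    calc _ ≤ σ ^ 2 * ((K₁ ^ 2 * (c + 1) + 1) * (r ^ 2 * N)) * r ^ 2 := by gcongr
      _ = _ := by ring
  have h4 : (K * (c + 1) + 2 * Real.pi / σ ^ 2 + 1) * N ≤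
      Real.pi * (τ * σ ^ 2 * (K₁ ^ 2 * (c + 1) + 1) * N ^ 2 * r ^ 4) /
        (2 * (σ ^ 2 * (K₁ ^ 2 * (c + 1) * (r ^ 2 * N) + 1) * r ^ 2)) := by
    have hτ' : K * (c + 1) + 2 * Real.pi / σ ^ 2 + 1 = Real.pi * τ / 2 := by
      rw [hτ]; field_simp
    calc _ = Real.pi * (τ * σ ^ 2 * (K₁ ^ 2 * (c + 1) + 1) * N ^ 2 * r ^ 4) /
          (2 * (σ ^ 2 * (K₁ ^ 2 * (c + 1) + 1) * (N * r ^ 4))) := by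
            rw [hτ']; field_simp
      _ ≤ _ := by gcongr
  have h5 : 2 * Real.pi * N / (σ ^ 2 * r ^ 2) ≤ 2 * Real.pi / σ ^ 2 * N := by
    calc _ = 2 * Real.pi / σ ^ 2 * (N / r ^ 2) := by field_simp
      _ ≤ _ := by gcongr; exact div_le_self hN0.le hr2
  have h6 : K * (m + N) ≤ K * (c + 1) * N := by
    calc _ ≤ K * (c * N + N) := by gcongr
      _ = _ := by ring
  rw [hS2]
  linarith

/-- The noise `e`. -/
lemma le_exponent_e {N r α q : ℝ} (hN : 1 ≤ N) (hr : 1 ≤ r) (hα : 0 < α) (hq : 0 < q)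
    (hα2 : N ^ 4 * r ^ 4 * α ^ 2 ≤ 1) :
    Real.pi / 4096 * (N / r ^ 2) ≤ Real.pi * (q / 64) ^ 2 / (α * q) ^ 2 := by
  have hpi := Real.pi_pos
  have h1 : Real.pi * (q / 64) ^ 2 / (α * q) ^ 2 = Real.pi / 4096 * (1 / α ^ 2) := by
    field_simp; norm_num
  rw [h1]
  refine mul_le_mul_of_nonneg_left ?_ (by positivity)
  rw [le_div_iff₀ (by positivity)]
  refine le_trans ?_ hα2
  have h3 : N / r ^ 2 ≤ N ^ 4 * r ^ 4 :=
    (div_le_self (by linarith) (one_le_pow₀ hr)).trans ((le_self_pow₀ hN (by norm_num)).trans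
      (le_mul_of_one_le_right (by positivity) (one_le_pow₀ hr)))
  gcongr

/-- The noise `⟨x₀, e₀⟩` for a key of squared norm at most `x₀ N² r⁴`. -/
lemma le_exponent_e₀ {N r α q x₀ : ℝ} (hN : 1 ≤ N) (hr : 1 ≤ r) (hα : 0 < α) (hq : 0 < q)
    (hx₀ : 0 < x₀) (hα2 : N ^ 4 * r ^ 4 * α ^ 2 ≤ 1) :
    Real.pi / 4096 * (N / r ^ 2) ≤
      x₀ * (Real.pi * (q / 64) ^ 2 / ((α * q) ^ 2 * (x₀ * N ^ 2 * r ^ 4))) := by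
  have hpi := Real.pi_pos
  have hr0 : 0 < r := by linarith
  have hN0 : 0 < N := by linarith
  have h1 : x₀ * (Real.pi * (q / 64) ^ 2 / ((α * q) ^ 2 * (x₀ * N ^ 2 * r ^ 4))) =
      Real.pi / 4096 * (1 / (N ^ 2 * r ^ 4 * α ^ 2)) := by
    field_simp; norm_num
  rw [h1]
  refine mul_le_mul_of_nonneg_left ?_ (by positivity)
  rw [le_div_iff₀ (by positivity)]
  refine le_trans ?_ hα2
  calc _ ≤ N ^ 2 * (N ^ 2 * r ^ 4 * α ^ 2) := by
        gcongr
        exact (div_le_self hN0.le (one_le_pow₀ hr)).trans (le_self_pow₀ hN (by norm_num))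
    _ = _ := by ring

/-- The noise `⟨x₁, e₁⟩`, which dominates: here the bound on `1 / α` is used up completely. -/
lemma le_exponent_e₁ {N r α q m c x₀ y₀ : ℝ} (hN : 1 ≤ N) (hr : 1 ≤ r) (hα : 0 < α) (hq : 0 < q)
    (hm0 : 0 < m) (hm : m ≤ c * N) (hx₀ : 0 < x₀) (hy₀ : 0 < y₀) (hc : 0 < c)
    (hα2 : N ^ 4 * r ^ 4 * α ^ 2 ≤ 1) :
    Real.pi / 4096 * (N / r ^ 2) ≤ ((y₀ + c) * x₀) * (Real.pi * (q / 64) ^ 2 /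
        ((y₀ * N * (α * q) ^ 2 + m * (α * q) ^ 2) * r ^ 2 * (x₀ * N ^ 2 * r ^ 4))) := by
  have hpi := Real.pi_pos
  have hr0 : 0 < r := by linarith
  have hN0 : 0 < N := by linarith
  have h0 : (y₀ * N * (α * q) ^ 2 + m * (α * q) ^ 2) * r ^ 2 * (x₀ * N ^ 2 * r ^ 4) ≤
      ((y₀ + c) * x₀) * (N ^ 3 * r ^ 6 * (α * q) ^ 2) := by
    calc _ ≤ (y₀ * N * (α * q) ^ 2 + (c * N) * (α * q) ^ 2) * r ^ 2 * (x₀ * N ^ 2 * r ^ 4) := by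
          gcongr
      _ = _ := by ring
  have h2 : N / r ^ 2 ≤ 1 / (N ^ 3 * r ^ 6 * α ^ 2) := by
    rw [div_le_div_iff₀ (by positivity) (by positivity)]
    calc _ = (N ^ 4 * r ^ 4 * α ^ 2) * r ^ 2 := by ring
      _ ≤ 1 * r ^ 2 := by gcongr
  calc Real.pi / 4096 * (N / r ^ 2) ≤ Real.pi / 4096 * (1 / (N ^ 3 * r ^ 6 * α ^ 2)) := by
        gcongr
    _ = ((y₀ + c) * x₀) * (Real.pi * (q / 64) ^ 2 /
        (((y₀ + c) * x₀) * (N ^ 3 * r ^ 6 * (α * q) ^ 2))) := by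
        have : 0 < (y₀ + c) * x₀ := by positivity
        generalize (y₀ + c) * x₀ = w at *
        field_simp; norm_num
    _ ≤ _ := by gcongr

/-- The re-encryption noise `⟨BD(c₁), r₂⟩`, controlled by the lower bound on `q`. -/
lemma le_exponent_r₂ {N r k q c : ℝ} (hN : 1 ≤ N) (hr : 1 ≤ r) (hk : 1 ≤ k) (hkN : k ≤ N)
    (hc : 0 < c) (hq2 : N ^ 3 * r ^ 2 ≤ q ^ 2) :
    Real.pi / 4096 * (N / r ^ 2) ≤
      (c + 1) * (Real.pi * (q / 64) ^ 2 / (r ^ 2 * ((c + 1) * N * k))) := by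
  have hpi := Real.pi_pos
  have hr0 : 0 < r := by linarith
  have hN0 : 0 < N := by linarith
  have hk0 : 0 < k := by linarith
  have h2 : N / r ^ 2 ≤ q ^ 2 / (r ^ 2 * (N * k)) := by
    rw [div_le_div_iff₀ (by positivity) (by positivity)]
    calc N * (r ^ 2 * (N * k)) ≤ N * (r ^ 2 * (N * N)) := by gcongr
      _ = (N ^ 3 * r ^ 2) * 1 := by ring
      _ ≤ q ^ 2 * r ^ 2 := by gcongr; exact one_le_pow₀ hr
  calc Real.pi / 4096 * (N / r ^ 2) ≤ Real.pi / 4096 * (q ^ 2 / (r ^ 2 * (N * k))) := by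
        gcongr
    _ = _ := by field_simp; ring

/-- The choice of the noise parameters, with `N = n k`: for squared norms `X = x₀ N² r⁴` of the key
and `Y = y₀ N (α q)²` of `e₀`, all exponents are at least `κ N / r²`. -/
lemma exists_noise_parameters {c σ K K₁ : ℝ} (hc : 0 < c) (hσ : 0 < σ) (hK0 : 0 < K)
    (hK₁0 : 0 < K₁) :
    ∃ κ x₀ y₀ : ℝ, 0 < κ ∧ 0 < x₀ ∧ ∀ N k r α q m : ℝ, 1 ≤ N → 1 ≤ k → k ≤ N → 1 ≤ r → 0 < α →
      0 < q → 0 < m → m ≤ c * N → N ^ (3 / 2 : ℝ) * r ≤ q → N ^ 2 * r ^ 2 ≤ 1 / α →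
      κ * (N / r ^ 2) ≤ N ∧
      κ * (N / r ^ 2) ≤ Real.pi * (x₀ * N ^ 2 * r ^ 4) /
          (2 * (σ ^ 2 * ((K₁ * r * Real.sqrt ((c + 1) * N)) ^ 2 + 1) * r ^ 2)) -
        K * (m + N) - 2 * Real.pi * N / (σ ^ 2 * r ^ 2) ∧
      κ * (N / r ^ 2) ≤ Real.pi * (q / 64) ^ 2 / (α * q) ^ 2 ∧
      κ * (N / r ^ 2) ≤ Real.pi * (q / 64) ^ 2 / ((α * q) ^ 2 * (x₀ * N ^ 2 * r ^ 4)) ∧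
      κ * (N / r ^ 2) ≤ Real.pi * (q / 64) ^ 2 /
        ((y₀ * N * (α * q) ^ 2 + m * (α * q) ^ 2) * r ^ 2 * (x₀ * N ^ 2 * r ^ 4)) ∧
      κ * (N / r ^ 2) ≤ Real.pi * (y₀ * N * (α * q) ^ 2) / (2 * (α * q) ^ 2) - K * m ∧
      (m + N) * k ≤ (c + 1) * N * k ∧
      κ * (N / r ^ 2) ≤ Real.pi * (q / 64) ^ 2 / (r ^ 2 * ((c + 1) * N * k)) := by
  have hpi := Real.pi_pos
  set τ : ℝ := 2 / Real.pi * (K * (c + 1) + 2 * Real.pi / σ ^ 2 + 1) with hτ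
  set x₀ : ℝ := τ * σ ^ 2 * (K₁ ^ 2 * (c + 1) + 1) with hx₀
  set y₀ : ℝ := 2 / Real.pi * (K * c + 1) with hy₀
  have hτ0 : 0 < τ := by positivity
  have hx₀0 : 0 < x₀ := by positivity
  have hy₀0 : 0 < y₀ := by positivity
  set L : ℝ := (1 + x₀) * (1 + y₀ + c) with hL
  have hL0 : 0 < L := by positivity
  set κ : ℝ := Real.pi / (4096 * L) with hκ
  have hκ0 : 0 < κ := by positivity
  have hκL : κ * L = Real.pi / 4096 := by rw [hκ]; field_simp
  have hLe : L = 1 + y₀ + c + x₀ + x₀ * y₀ + x₀ * c := by rw [hL]; ring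
  have hxy := mul_pos hx₀0 hy₀0
  have hxc := mul_pos hx₀0 hc
  have hLx : x₀ ≤ L := by linarith
  have hL1 : 1 ≤ L := by linarith
  have hLc : c + 1 ≤ L := by linarith
  have hLxy : (y₀ + c) * x₀ ≤ L := by linarith
  have hκ1 : κ ≤ 1 := by
    rw [hκ, div_le_one (by positivity)]
    linarith [Real.pi_le_four]
  refine ⟨κ, x₀, y₀, hκ0, hx₀0, ?_⟩
  clear_value κ L
  intro N k r α q m hN1 hk hkN hr hα hq0 hm0 hmc hqN hαN
  have hr0 : 0 < r := by linarith
  have hN0 : 0 < N := by linarith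
  set θ : ℝ := κ * (N / r ^ 2) with hθ
  have hr2 : 1 ≤ r ^ 2 := one_le_pow₀ hr
  have hNr : N / r ^ 2 ≤ N := div_le_self hN0.le hr2
  have hθN : θ ≤ N := by
    calc θ ≤ 1 * N := by rw [hθ]; gcongr
      _ = N := one_mul N
  -- everything is bounded below by `κ L N / r²`
  have hθ' {t : ℝ} (ht : Real.pi / 4096 * (N / r ^ 2) ≤ L * t) : θ ≤ t := by
    rw [← hκL] at ht
    have : L * (κ * (N / r ^ 2)) ≤ L * t := by linarith
    exact le_of_mul_le_mul_left this hL0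
  have hα2 : N ^ 4 * r ^ 4 * α ^ 2 ≤ 1 := by
    rw [le_div_iff₀ hα] at hαN
    calc N ^ 4 * r ^ 4 * α ^ 2 = (N ^ 2 * r ^ 2 * α) ^ 2 := by ring
      _ ≤ 1 := pow_le_one₀ (by positivity) hαN
  have hq2 : N ^ 3 * r ^ 2 ≤ q ^ 2 := by
    have h := pow_le_pow_left₀ (by positivity) hqN 2
    have h3 : (N ^ (3 / 2 : ℝ)) ^ 2 = N ^ 3 := by
      rw [← Real.rpow_natCast, ← Real.rpow_mul hN0.le]
      norm_num
    rwa [mul_pow, h3] at h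
  refine ⟨hθN, hθN.trans (le_key_exponent hc hσ hK0 hτ hN1 hr hmc), hθ' ?_, hθ' ?_, hθ' ?_, ?_, ?_,
    hθ' ?_⟩
  · refine (le_exponent_e hN1 hr hα hq0 hα2).trans (le_mul_of_one_le_left (by positivity) hL1)
  · refine (le_exponent_e₀ hN1 hr hα hq0 hx₀0 hα2).trans ?_
    gcongr
  · refine (le_exponent_e₁ hN1 hr hα hq0 hm0 hmc hx₀0 hy₀0 hc hα2).trans ?_
    gcongr
  · have h1 : Real.pi * (y₀ * N * (α * q) ^ 2) / (2 * (α * q) ^ 2) = (K * c + 1) * N := by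
      rw [hy₀]; field_simp
    rw [h1]
    have h2 : K * m ≤ K * (c * N) := by gcongr
    linarith
  · calc (m + N) * k ≤ (c * N + N) * k := by gcongr
      _ = _ := by ring
  · refine (le_exponent_r₂ hN1 hr hk hkN hc hq2).trans ?_
    gcongr

/-! ### Correctness at one value of the security parameter -/

/-- Both experiments fail with probability at most `12 exp (-θ) + 4 δ`. Here `S` bounds the largest
singular value of `R`, and `X`, `Y`, `V` bound the squared norms of the key, of `e₀` and of the bits
of a ciphertext. The noise budget `q / 16` is split into four parts of size `q / 64`. -/
lemma selectiveScheme_failure_le {K : ℝ} (hK : IsNormTailConstant K)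
    {n q mbar : ℕ} [NeZero q] (hq : 2 ≤ q) (hmbar : 1 ≤ mbar) {σ r α δ : ℝ} (hσ : 0 < σ)
    (hr : 0 < r) (hα : 0 < α) (hδ : 0 ≤ δ)
    (H : (Fin n → ZMod q) → Matrix (Fin n) (Fin n) (ZMod q)) (Samp : Sampler n q mbar)
    (hH : ∀ id, id ≠ 0 → IsUnit (H id)) (hSamp : Samp.IsClose σ r δ) {S X Y V θ : ℝ}
    (hX : 0 < X) (hV : 0 < V)
    (hR : (gaussianMatrix (Fin mbar) (GIdx n q) r).toOuterMeasure {R | S < s₁ R} ≤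
      ENNReal.ofReal (Real.exp (-θ)))
    (h₀ : θ ≤ Real.pi * X / (2 * (σ ^ 2 * (S ^ 2 + 1) * r ^ 2)) -
      K * (mbar + n * bitLen q) - 2 * Real.pi * (n * bitLen q) / (σ ^ 2 * r ^ 2))
    (h₁ : θ ≤ Real.pi * (q / 64) ^ 2 / (α * q) ^ 2)
    (h₂ : θ ≤ Real.pi * (q / 64) ^ 2 / ((α * q) ^ 2 * X))
    (h₃ : θ ≤ Real.pi * (q / 64) ^ 2 / ((Y + mbar * (α * q) ^ 2) * r ^ 2 * X))
    (h₄ : θ ≤ Real.pi * Y / (2 * (α * q) ^ 2) - K * mbar)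
    (hVm : ((mbar + n * bitLen q : ℝ)) * bitLen q ≤ V)
    (h₅ : θ ≤ Real.pi * (q / 64) ^ 2 / (r ^ 2 * V)) (b : Bool)
    (idi idj : {id : Fin n → ZMod q // id ≠ 0}) :
    ((selectiveScheme n q mbar r α H Samp).decOriginal idi b).toOuterMeasure {some b}ᶜ ≤
        ENNReal.ofReal (12 * Real.exp (-θ) + 4 * δ) ∧
      ((selectiveScheme n q mbar r α H Samp).decReEncrypted idi idj b).toOuterMeasure {some b}ᶜ ≤
        ENNReal.ofReal (12 * Real.exp (-θ) + 4 * δ) := by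
  have hexp := Real.exp_pos (-θ)
  have hM : (0 : ℝ) ≤ (q : ℝ) / 64 := by positivity
  have hkey (R : Matrix (Fin mbar) (GIdx n q) ℤ) (hRS : s₁ R ≤ S)
      (Abar : Matrix (Fin n) (Fin mbar) (ZMod q)) (id : {id : Fin n → ZMod q // id ≠ 0})
      (u : Fin n → ZMod q) := sampler_tail hK hσ hr hSamp R Abar (hH id.1 id.2) u hRS hX.le h₀
  have hdec {x : Idx n q mbar → ℤ} {M : ℝ} (hMq : M ≤ (q : ℝ) / 16)
      {ct : (Idx n q mbar → ZMod q) × ZMod q} (hct : HasNoise x b M ct) :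
      (PMF.pure (some (decrypt x ct))).toOuterMeasure {some b}ᶜ ≤ 0 := by
    rw [decrypt_eq_of_hasNoise hq (hct.mono hMq)]
    exact (toOuterMeasure_pure_eq_zero (by simp)).le
  have hkey0 : 0 ≤ Real.exp (-θ) + 2 * δ := by positivity
  constructor
  · have hsum : ENNReal.ofReal (Real.exp (-θ)) + (ENNReal.ofReal (Real.exp (-θ) + 2 * δ) +
        (ENNReal.ofReal (7 * Real.exp (-θ)) + 0)) ≤
        ENNReal.ofReal (12 * Real.exp (-θ) + 4 * δ) := by
      rw [add_zero, ← ENNReal.ofReal_add hkey0 (by positivity),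
        ← ENNReal.ofReal_add hexp.le (by positivity)]
      exact ENNReal.ofReal_le_ofReal (by linarith)
    refine le_trans ?_ hsum
    simp only [Scheme.decOriginal, selectiveScheme, PMF.bind_bind, PMF.pure_bind]
    refine toOuterMeasure_bind_le_of_forall _ _ _ fun Abar => ?_
    refine toOuterMeasure_bind_le _ _ _ _ hR fun R hRS => ?_
    refine toOuterMeasure_bind_le_of_forall _ _ _ fun u => ?_
    have hcol : (publicMatrix (Matrix.of Abar) R).toCols₁ = Matrix.of Abar :=
      Matrix.toCols₁_fromCols _ _
    rw [hcol]
    refine toOuterMeasure_bind_le _ _ _ _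
      (hkey R (not_lt.1 hRS) (Matrix.of Abar) idi u) fun x hx => ?_
    obtain ⟨hxΛ, hxX⟩ := not_not.1 hx
    refine toOuterMeasure_bind_le _ _ _ _
      (encrypt_noise_tail hK hmbar hr hα hxΛ b hX hxX hM h₁ h₂ h₃ h₄) fun ct hct => ?_
    exact hdec (by linarith) (not_not.1 hct)
  · have hsum : ENNReal.ofReal (Real.exp (-θ)) + (ENNReal.ofReal (Real.exp (-θ) + 2 * δ) +
        (ENNReal.ofReal (Real.exp (-θ) + 2 * δ) + (ENNReal.ofReal (7 * Real.exp (-θ)) +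
        (ENNReal.ofReal (2 * Real.exp (-θ)) + 0)))) ≤
        ENNReal.ofReal (12 * Real.exp (-θ) + 4 * δ) := by
      rw [add_zero, ← ENNReal.ofReal_add (by positivity) (by positivity),
        ← ENNReal.ofReal_add hkey0 (by positivity), ← ENNReal.ofReal_add hkey0 (by positivity),
        ← ENNReal.ofReal_add hexp.le (by positivity)]
      exact ENNReal.ofReal_le_ofReal (by linarith)
    refine le_trans ?_ hsum
    simp only [Scheme.decReEncrypted, selectiveScheme, PMF.bind_bind, PMF.pure_bind]
    refine toOuterMeasure_bind_le_of_forall _ _ _ fun Abar => ?_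
    refine toOuterMeasure_bind_le _ _ _ _ hR fun R hRS => ?_
    refine toOuterMeasure_bind_le_of_forall _ _ _ fun u => ?_
    have hcol : (publicMatrix (Matrix.of Abar) R).toCols₁ = Matrix.of Abar :=
      Matrix.toCols₁_fromCols _ _
    rw [hcol]
    refine toOuterMeasure_bind_le _ _ _ _
      (hkey R (not_lt.1 hRS) (Matrix.of Abar) idi u) fun xi hxi => ?_
    obtain ⟨hxiΛ, hxiX⟩ := not_not.1 hxi
    refine toOuterMeasure_bind_le _ _ _ _
      (hkey R (not_lt.1 hRS) (Matrix.of Abar) idj u) fun xj hxj => ?_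
    obtain ⟨hxjΛ, -⟩ := not_not.1 hxj
    -- the re-encryption key is independent of the ciphertext, so it may be drawn last
    rw [PMF.bind_comm]
    refine toOuterMeasure_bind_le _ _ _ _
      (encrypt_noise_tail hK hmbar hr hα hxiΛ b hX hxiX hM h₁ h₂ h₃ h₄) fun ct hct => ?_
    refine toOuterMeasure_bind_le _ _ _ _
      (reKey_noise_tail hr hxjΛ (not_not.1 hct) hM hV hVm h₅) fun rk hrk => ?_
    exact hdec (by linarith) (not_not.1 hrk)

/-- Both experiments at a single `n`, with `N = n k`, fail with probability at most
`12 exp (-κ N / r²) + 4 δ`. -/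
lemma exists_selectiveScheme_failure_le {c σ : ℝ} (hc : 0 < c) (hσ : 0 < σ) :
    ∃ κ : ℝ, 0 < κ ∧ ∀ (n q mbar : ℕ) [NeZero q] (r α δ : ℝ)
      (H : (Fin n → ZMod q) → Matrix (Fin n) (Fin n) (ZMod q)) (Samp : Sampler n q mbar),
      1 ≤ n → 2 ≤ q → 1 ≤ mbar → (mbar : ℝ) ≤ c * (n * bitLen q) → 1 ≤ r → 0 < α → 0 ≤ δ →
      (n * bitLen q : ℝ) ^ (3 / 2 : ℝ) * r ≤ q →
      (n * bitLen q : ℝ) ^ 2 * r ^ 2 ≤ 1 / α →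
      (∀ id, id ≠ 0 → IsUnit (H id)) → Samp.IsClose σ r δ →
      ∀ (b : Bool) (idi idj : {id : Fin n → ZMod q // id ≠ 0}),
      ((selectiveScheme n q mbar r α H Samp).decOriginal idi b).toOuterMeasure {some b}ᶜ ≤
          ENNReal.ofReal (12 * Real.exp (-(κ * (n * bitLen q / r ^ 2))) + 4 * δ) ∧
        ((selectiveScheme n q mbar r α H Samp).decReEncrypted idi idj b).toOuterMeasure
            {some b}ᶜ ≤
          ENNReal.ofReal (12 * Real.exp (-(κ * (n * bitLen q / r ^ 2))) + 4 * δ) := by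
  have hpi := Real.pi_pos
  obtain ⟨K, hK0, hK⟩ := exists_isNormTailConstant
  obtain ⟨K₁, hK₁0, hK₁⟩ := exists_gaussianMatrix_s₁_tail
  obtain ⟨κ, x₀, y₀, hκ0, hx₀0, hpar⟩ := exists_noise_parameters hc hσ hK0 hK₁0
  refine ⟨κ, hκ0, ?_⟩
  intro n q mbar _ r α δ H Samp hn hq hmbar hmc hr hα hδ hqN hαN hH hSamp b idi idj
  have hr0 : 0 < r := by linarith
  have hq0 : (0 : ℝ) < q := by exact_mod_cast NeZero.pos q
  have hk : (1 : ℝ) ≤ bitLen q := by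
    exact_mod_cast Nat.clog_pos one_lt_two hq
  have hn' : (1 : ℝ) ≤ n := by exact_mod_cast hn
  have hkN : (bitLen q : ℝ) ≤ n * bitLen q := le_mul_of_one_le_left (by linarith) hn'
  have hN1 : (1 : ℝ) ≤ n * bitLen q := hk.trans hkN
  have hm0 : (0 : ℝ) < mbar := by exact_mod_cast hmbar
  obtain ⟨hθN, h₀, h₁, h₂, h₃, h₄, hVm, h₅⟩ :=
    hpar _ _ r α q mbar hN1 hk hkN hr hα hq0 hm0 hmc hqN hαN
  refine selectiveScheme_failure_le hK hq hmbar hσ hr0 hα hδ H Samp hH hSamp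
    (by positivity) (by positivity) ?_ h₀ h₁ h₂ h₃ h₄ hVm h₅ b idi idj
  have hND : (n * bitLen q : ℝ) ≤ (c + 1) * (n * bitLen q) :=
    le_mul_of_one_le_left (by linarith) (by linarith)
  refine (hK₁ (Fin mbar) (GIdx n q) ((c + 1) * (n * bitLen q)) r (by positivity) hr0 ?_ ?_).trans
    (ENNReal.ofReal_le_ofReal (Real.exp_le_exp.2 ?_))
  · rw [Fintype.card_fin]
    linarith
  · simpa using hND
  · linarith

/-! ### Asymptotics -/

/-- `exp (-θ)` is negligible once `θ` grows faster than `log n`. -/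
lemma negligible_exp_neg {θ : ℕ → ℝ}
    (hθ : ∀ A : ℝ, ∀ᶠ n : ℕ in atTop, A * Real.log n ≤ θ n) :
    Negligible fun n => Real.exp (-θ n) := by
  intro d
  have hinv : Tendsto (fun n : ℕ => ((n : ℝ))⁻¹) atTop (nhds 0) :=
    tendsto_inv_atTop_nhds_zero_nat
  refine squeeze_zero' (Eventually.of_forall fun n => by positivity) ?_ hinv
  filter_upwards [hθ (d + 1), eventually_ge_atTop 1] with n hn h1
  have hn0 : (0 : ℝ) < n := by exact_mod_cast h1
  calc (n : ℝ) ^ d * Real.exp (-θ n) ≤ (n : ℝ) ^ d * Real.exp (-((d + 1 : ℝ) * Real.log n)) := by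
        gcongr
    _ = (n : ℝ)⁻¹ := by
        have h2 : Real.exp ((d + 1 : ℝ) * Real.log n) = (n : ℝ) ^ (d + 1) := by
          rw [← Real.exp_log (pow_pos hn0 (d + 1)), Real.log_pow]
          push_cast
          rfl
        rw [Real.exp_neg, h2, pow_succ]
        field_simp

end IBPRE

theorem mainTheorem3 (c σ : ℝ) (hc : 0 < c) (hσ : 0 < σ) :
    ∃ C : ℝ, 0 < C ∧
      ∀ (q mbar : ℕ → ℕ) [∀ n, NeZero (q n)] (r α δ : ℕ → ℝ)
        (H : ∀ n, (Fin n → ZMod (q n)) → Matrix (Fin n) (Fin n) (ZMod (q n)))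
        (Samp : ∀ n, IBPRE.Sampler n (q n) (mbar n)),
        -- the modulus is a prime power of polynomial size
        (∀ n, IsPrimePow (q n)) →
        (∃ d : ℕ, ∀ᶠ n in atTop, q n ≤ n ^ d) →
        -- `m̄ = O(nk)`
        (∀ n, 1 ≤ mbar n) →
        (∀ᶠ n in atTop, (mbar n : ℝ) ≤ c * (n * IBPRE.bitLen (q n))) →
        -- `r = ω(√(log n))` and `r = o(√n)`
        (∀ n, 0 < r n) →
        ((fun n : ℕ => Real.sqrt (Real.log n)) =o[atTop] r) →
        (r =o[atTop] fun n : ℕ => Real.sqrt n) →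
        -- the modulus is large enough
        (∀ᶠ n in atTop,
          C * ((n * IBPRE.bitLen (q n) : ℝ) ^ (3 / 2 : ℝ) * r n) ≤ q n) →
        -- the error rate: `1 / α` is at least a large constant times `(nk)² r²`
        (∀ n, 0 < α n) →
        (∀ᶠ n in atTop, C * ((n * IBPRE.bitLen (q n) : ℝ) ^ 2 * r n ^ 2) ≤ 1 / α n) →
        -- the encoding of nonzero identities by invertible matrices
        (∀ n id, id ≠ 0 → IsUnit (H n id)) →
        -- the preimage sampler is correct up to a negligible statistical distance
        IBPRE.Negligible δ →
        (∀ n, (Samp n).IsClose σ (r n) (δ n)) →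
        IBPRE.SingleHopCorrect fun n =>
          IBPRE.selectiveScheme n (q n) (mbar n) (r n) (α n) (H n) (Samp n) := by
  classical
  obtain ⟨κ, hκ, hmain⟩ := IBPRE.exists_selectiveScheme_failure_le hc hσ
  refine ⟨1, one_pos, ?_⟩
  intro q mbar _ r α δ H Samp hpp _ hmbar hmc hr hlog hsqrt hq hα hαN hH hδ hSamp
  set N : ℕ → ℝ := fun n => n * IBPRE.bitLen (q n) with hN
  set f : ℕ → ℝ := fun n => 12 * Real.exp (-(κ * (N n / r n ^ 2))) + 4 * δ n with hf
  have hq2 (n : ℕ) : 2 ≤ q n := (hpp n).two_le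
  have hδ0 (n : ℕ) : 0 ≤ δ n :=
    (IBPRE.statDist_nonneg _ _).trans (hSamp n 0 0 1 0 isUnit_one)
  have hf0 (n : ℕ) : 0 ≤ f n := by
    have := hδ0 n
    have := Real.exp_pos (-(κ * (N n / r n ^ 2)))
    simp only [hf]
    positivity
  have hr1 : ∀ᶠ n in atTop, 1 ≤ r n := by
    filter_upwards [hlog.bound one_pos, eventually_ge_atTop 3] with n hn h3
    rw [one_mul, Real.norm_of_nonneg (Real.sqrt_nonneg _), Real.norm_of_nonneg (hr n).le] at hn
    refine le_trans ?_ hn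
    rw [Real.one_le_sqrt, Real.le_log_iff_exp_le (by positivity)]
    have : (3 : ℝ) ≤ n := by exact_mod_cast h3
    linarith [Real.exp_one_lt_d9]
  have hcond : ∀ᶠ n : ℕ in atTop, 1 ≤ n ∧ (mbar n : ℝ) ≤ c * N n ∧ 1 ≤ r n ∧
      N n ^ (3 / 2 : ℝ) * r n ≤ q n ∧ N n ^ 2 * r n ^ 2 ≤ 1 / α n := by
    filter_upwards [hmc, hq, hαN, hr1, eventually_ge_atTop 1] with n h1 h2 h3 h4 h5
    rw [one_mul] at h2 h3
    exact ⟨h5, h1, h4, h2, h3⟩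
  have hneg : IBPRE.Negligible f := by
    have h1 : IBPRE.Negligible fun n => Real.exp (-(κ * (N n / r n ^ 2))) := by
      refine IBPRE.negligible_exp_neg fun A => ?_
      have hA : 0 < κ / (|A| + 1) := by positivity
      filter_upwards [hcond, hsqrt.bound (Real.sqrt_pos.2 hA)] with n hn hs
      obtain ⟨hn1, -, hr1, hqn, -⟩ := hn
      have hn1' : (1 : ℝ) ≤ n := by exact_mod_cast hn1
      have hk : (1 : ℝ) ≤ IBPRE.bitLen (q n) := by
        exact_mod_cast Nat.clog_pos one_lt_two (hq2 n)
      have hnN : (n : ℝ) ≤ N n := le_mul_of_one_le_right (by linarith) hk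
      have hN1 : 1 ≤ N n := hn1'.trans hnN
      have hnq : (n : ℝ) ≤ q n := by
        calc (n : ℝ) ≤ N n := hnN
          _ = N n ^ (1 : ℝ) := (Real.rpow_one _).symm
          _ ≤ N n ^ (3 / 2 : ℝ) := Real.rpow_le_rpow_of_exponent_le hN1 (by norm_num)
          _ ≤ N n ^ (3 / 2 : ℝ) * r n := le_mul_of_one_le_right (by positivity) hr1
          _ ≤ q n := hqn
      have hlogk : Real.log n ≤ IBPRE.bitLen (q n) := by
        have h2 : (q n : ℝ) ≤ 2 ^ IBPRE.bitLen (q n) := by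
          exact_mod_cast Nat.le_pow_clog one_lt_two (q n)
        have h3 : Real.log n ≤ Real.log (2 ^ IBPRE.bitLen (q n)) :=
          Real.log_le_log (by linarith) (hnq.trans h2)
        rw [Real.log_pow] at h3
        nlinarith [Real.log_two_lt_d9, Real.log_two_gt_d9]
      rw [Real.norm_of_nonneg (hr n).le, Real.norm_of_nonneg (Real.sqrt_nonneg _)] at hs
      have hr2 : r n ^ 2 ≤ κ / (|A| + 1) * n := by
        have := pow_le_pow_left₀ (hr n).le hs 2
        rwa [mul_pow, Real.sq_sqrt hA.le, Real.sq_sqrt (by positivity)] at this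
      have hrpos : 0 < r n ^ 2 := by have := hr n; positivity
      have hdiv : |A| + 1 ≤ κ * (n / r n ^ 2) := by
        rw [← mul_div_assoc, le_div_iff₀ hrpos]
        calc (|A| + 1) * r n ^ 2 ≤ (|A| + 1) * (κ / (|A| + 1) * n) := by gcongr
          _ = κ * n := by field_simp
      have hlog0 : 0 ≤ Real.log n := Real.log_nonneg hn1'
      calc A * Real.log n ≤ (|A| + 1) * Real.log n := by
            gcongr; linarith [le_abs_self A]
        _ ≤ κ * (n / r n ^ 2) * IBPRE.bitLen (q n) := by gcongr
        _ = κ * (N n / r n ^ 2) := by simp only [hN]; ring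
    exact (h1.const_mul 12).add (hδ.const_mul 4)
  -- the finitely many small `n` are covered by the trivial bound `ε n = 1`
  let P : ℕ → Prop := fun n => 1 ≤ n ∧ (mbar n : ℝ) ≤ c * N n ∧ 1 ≤ r n ∧
      N n ^ (3 / 2 : ℝ) * r n ≤ q n ∧ N n ^ 2 * r n ^ 2 ≤ 1 / α n
  refine ⟨fun n => if P n then f n else 1, ?_, fun n b => ?_⟩
  · refine hneg.congr' ?_
    filter_upwards [hcond] with n hn
    exact (if_pos hn).symm
  · by_cases hP : P n
    · simp only [if_pos hP]
      have hfail := hmain n (q n) (mbar n) (r n) (α n) (δ n) (H n) (Samp n) hP.1 (hq2 n) (hmbar n)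
        hP.2.1 hP.2.2.1 (hα n) (hδ0 n) hP.2.2.2.1 hP.2.2.2.2 (hH n) (hSamp n) b
      exact ⟨fun id => IBPRE.one_sub_le_toReal_of_compl _ _ (hf0 n) (hfail id id).1,
        fun idi idj => IBPRE.one_sub_le_toReal_of_compl _ _ (hf0 n) (hfail idi idj).2⟩
    · simp only [if_neg hP, sub_self]
      exact ⟨fun _ => ENNReal.toReal_nonneg, fun _ _ => ENNReal.toReal_nonneg⟩
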